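/- Let $k,d\ge 0$ be integers, $n=k+d$, let $\Theta$ be a real antisymmetric $n\times n$ matrix with lower right $d\times d$ corner $\Theta_d$, let $r=(r_1,\dots,r_k,0,\dots,0)\in\mathbb R^n$ with $r_1,\dots,r_k>0$, and let $0<\beta<\infty$. For an antisymmetric real $m\times m$ matrix $D$ put $\sigma_D(p,q)=e^{-\pi i\langle p,Dq\rangle}$ for $p,q\in\mathbb N^m$, and let $\mathcal T_r(\mathbb N^m,\sigma_D)$ be the C*-algebra of operators on $\ell^2(\mathbb N^m)$ generated by the isometries $L_p\delta_q=\sigma_D(p,q)\delta_{p+q}$. Let $\alpha$ be the dynamics on $\mathcal T_r(\mathbb N^n,\sigma_\Theta)$ with $\alpha_t(L_p)=e^{i\langle p,r\rangle t}L_p$. A $\mathrm{KMS}_\beta$ state is a state $\varphi$ with $\varphi(AB)=\varphi(B\alpha_{i\beta}(A))$ for all $\alpha$-analytic $A$ and all $B$. Put $Q=\prod_{j=1}^k(1-L_{e_j}L_{e_j}^*)$ and $Z(\beta)=\sum_{l\in\mathbb N^k}e^{-\beta\langle l,r\rangle}$; identify $\mathbb N^k$ with $\mathbb N^k\times 0_d$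 and $\mathbb N^d$ with $0_k\times\mathbb N^d$. Then $\mathcal T_r(\mathbb N^d,\sigma_{\Theta_d})$ is canonically $*$-isomorphic to $\mathrm C^*(L_x: x\in 0_k\times\mathbb N^d)\subseteq\mathcal T_r(\mathbb N^n,\sigma_\Theta)$ via $L_x\mapsto L_x$, and the compression $\rho_Q(X)=QXQ$ is a $*$-isomorphism of the latter algebra onto the corner $Q\,\mathcal T_r(\mathbb N^n,\sigma_\Theta)\,Q$. With the first identification, for each tracial state $\tau$ of $\mathcal T_r(\mathbb N^d,\sigma_{\Theta_d})$ the convergent series $$T_\beta(\tau\circ\rho_Q^{-1})(X)=\frac1{Z(\beta)}\sum_{l\in\mathbb N^k}e^{-\beta\langle l,r\rangle}\,\tau\big(\rho_Q^{-1}(QL_l^*XL_lQ)\big),\qquad X\in\mathcal T_r(\mathbb N^n,\sigma_\Theta),$$ defines a $\mathrm{KMS}_\beta$ state of $(\mathcal T_r(\mathbb N^n,\sigma_\Theta),\alpha)$. It satisfies, for all $p,q\in\mathbb N^k$ and $x,y\in\mathbb N^d$, $$T_\beta(\tau\circ\rho_Q^{-1})(L_pL_xL_y^*L_q^*)=\delta_{p,q}\,\tau(L_xL_y^*)\prod_{j=1}^k\frac{e^{-\beta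 r_jp_j}(1-e^{-\beta r_j})}{1-e^{-\beta r_j+2\pi i\langle\Theta(x-y),e_j\rangle}},$$ and it is the only continuous linear functional that does. The map $\tau\mapsto T_\beta(\tau\circ\rho_Q^{-1})$ is an affine weak* homeomorphism of the set of tracial states of $\mathcal T_r(\mathbb N^d,\sigma_{\Theta_d})$ onto the set of all $\mathrm{KMS}_\beta$ states of $(\mathcal T_r(\mathbb N^n,\sigma_\Theta),\alpha)$. -/

import Mathlib

open scoped ComplexOrder

noncomputable section

namespace ToeplitzTorus

/-! ### States of a unital C*-algebra, traces, KMS states, corners -/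

section General

variable {A : Type*} [NormedRing A] [StarRing A] [NormedAlgebra ℂ A]

/-- The states of a unital C*-algebra: unital positive functionals (with the weak* topology, as a
subset of the weak dual). -/
def states (A : Type*) [NormedRing A] [StarRing A] [NormedAlgebra ℂ A] : Set (WeakDual ℂ A) :=
  {φ | φ 1 = 1 ∧ ∀ a : A, 0 ≤ φ (star a * a)}

/-- The tracial states. -/
def tracialStates (A : Type*) [NormedRing A] [StarRing A] [NormedAlgebra ℂ A] :
    Set (WeakDual ℂ A) :=
  {φ | φ ∈ states A ∧ ∀ a b : A, φ (a * b) = φ (b * a)}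

/-- `F` is the entire extension of the orbit `t ↦ α t a`; an element is `α`-analytic when such an
`F` exists, and then `α z a` means `F z`. -/
def IsEntireExtension (α : ℝ → A → A) (a : A) (F : ℂ → A) : Prop :=
  Differentiable ℂ F ∧ ∀ t : ℝ, F t = α t a

/-- The `KMS_β` states for `α`: the states `φ` with `φ (a b) = φ (b α_{iβ}(a))` for all analytic
elements `a` and all elements `b`. -/
def kmsStates (α : ℝ → A → A) (β : ℝ) : Set (WeakDual ℂ A) :=
  {φ | φ ∈ states A ∧ ∀ (a : A) (F : ℂ → A), IsEntireExtension α a F →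
    ∀ b : A, φ (a * b) = φ (b * F (Complex.I * β))}

/-- The corner `Q A Q` of a projection `Q`. -/
def corner (Q : A) (hQ : IsStarProjection Q) : NonUnitalStarSubalgebra ℂ A where
  carrier := {X | Q * X * Q = X}
  add_mem' {X Y} hX hY := by
    simp only [Set.mem_ofPred_eq] at *
    rw [mul_add, add_mul, hX, hY]
  zero_mem' := by simp
  mul_mem' {X Y} hX hY := by
    simp only [Set.mem_ofPred_eq] at *
    have h1 : Q * X = X := by
      rw [← hX, ← mul_assoc, ← mul_assoc, hQ.isIdempotentElem.eq]
    have h2 : Y * Q = Y := by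
      rw [← hY, mul_assoc, hQ.isIdempotentElem.eq]
    rw [← mul_assoc, h1, mul_assoc, h2]
  smul_mem' c X hX := by
    simp only [Set.mem_ofPred_eq] at *
    rw [mul_smul_comm, smul_mul_assoc, hX]
  star_mem' {X} hX := by
    simp only [Set.mem_ofPred_eq] at *
    have h := congrArg star hX
    rwa [star_mul, star_mul, hQ.isSelfAdjoint.star_eq, ← mul_assoc] at h

/-- The compression `X ↦ Q X Q` of `A` to the corner. -/
def compress (Q : A) (hQ : IsStarProjection Q) (X : A) : corner Q hQ :=
  ⟨Q * X * Q, by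
    change Q * (Q * X * Q) * Q = Q * X * Q
    have h := hQ.isIdempotentElem.eq
    calc Q * (Q * X * Q) * Q = (Q * Q) * X * (Q * Q) := by simp only [mul_assoc]
      _ = Q * X * Q := by rw [h]⟩

end General

/-! ### Operators on `ℓ²(ℕⁿ)` -/

/-- The Hilbert space `ℓ²(ℕⁿ)`. -/
abbrev Ell2 (n : ℕ) : Type := lp (fun _ : Fin n → ℕ => ℂ) 2

/-- The canonical orthonormal basis vector `δ_q`. -/
def basisVec {n : ℕ} (q : Fin n → ℕ) : Ell2 n := lp.single 2 q (1 : ℂ)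

theorem inner_basisVec {n : ℕ} (p q : Fin n → ℕ) :
    inner ℂ (basisVec p) (basisVec q) = if p = q then (1 : ℂ) else 0 := by
  unfold basisVec
  rw [lp.inner_single_left, lp.single_apply]
  by_cases h : p = q
  · subst h; simp
  · simp [h]

theorem orthonormal_smul_basisVec {n : ℕ} (s : (Fin n → ℕ) → (Fin n → ℕ))
    (hs : Function.Injective s) (c : (Fin n → ℕ) → Circle) :
    Orthonormal ℂ (fun q => (c q : ℂ) • basisVec (s q)) := by
  rw [orthonormal_iff_ite]
  intro p q
  rw [inner_smul_left, inner_smul_right, inner_basisVec]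
  by_cases h : p = q
  · subst h
    simp [← Complex.normSq_eq_conj_mul_self]
  · simp [h, hs.ne h]

/-- The isometry of `ℓ²(ℕⁿ)` with `δ_q ↦ c(q) δ_{s(q)}`, for an injective map `s`. -/
def monomialIsometry {n : ℕ} (s : (Fin n → ℕ) → (Fin n → ℕ)) (hs : Function.Injective s)
    (c : (Fin n → ℕ) → Circle) : Ell2 n →ₗᵢ[ℂ] Ell2 n :=
  (orthonormal_smul_basisVec s hs c).orthogonalFamily.linearIsometry

theorem monomialIsometry_basisVec {n : ℕ} (s : (Fin n → ℕ) → (Fin n → ℕ))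
    (hs : Function.Injective s) (c : (Fin n → ℕ) → Circle) (q : Fin n → ℕ) :
    monomialIsometry s hs c (basisVec q) = (c q : ℂ) • basisVec (s q) := by
  unfold monomialIsometry
  conv_lhs => rw [basisVec]
  rw [OrthogonalFamily.linearIsometry_apply_single]
  simp

theorem clm_ext {n : ℕ} {S T : Ell2 n →L[ℂ] Ell2 n}
    (h : ∀ q, S (basisVec q) = T (basisVec q)) : S = T := by
  refine lp.ext_continuousLinearMap (by simp) fun q => ?_
  ext1
  exact h q

theorem eq_of_inner_basisVec {n : ℕ} {f g : Ell2 n}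
    (h : ∀ q, inner ℂ (basisVec q) f = inner ℂ (basisVec q) g) : f = g := by
  apply lp.ext
  funext q
  have := h q
  unfold basisVec at this
  simpa [lp.inner_single_left] using this

/-! ### The Toeplitz noncommutative torus -/

/-- The pairing `⟨p, v⟩ = ∑ j, p_j v_j` of `p ∈ ℕⁿ` with `v ∈ ℝⁿ`. -/
def pairing {n : ℕ} (p : Fin n → ℕ) (v : Fin n → ℝ) : ℝ := ∑ j, (p j : ℝ) * v j

/-- The cocycle `σ_Θ(p, q) = exp (-π i ⟨p, Θ q⟩)`. -/
def cocycle {n : ℕ} (Θ : Matrix (Fin n) (Fin n) ℝ) (p q : Fin n → ℕ) : Circle :=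
  Circle.exp (-(Real.pi * pairing p (Θ.mulVec fun j => (q j : ℝ))))

/-- The isometry `L_p δ_q = σ_Θ(p, q) δ_{p+q}` of the left regular `σ_Θ`-representation. -/
def leftRegular {n : ℕ} (Θ : Matrix (Fin n) (Fin n) ℝ) (p : Fin n → ℕ) : Ell2 n →L[ℂ] Ell2 n :=
  (monomialIsometry (fun q => p + q) (add_right_injective p)
    (cocycle Θ p)).toContinuousLinearMap

/-- The Toeplitz noncommutative torus `T_r(ℕⁿ, σ_Θ)`: the C*-algebra of operators on `ℓ²(ℕⁿ)`
generated by all `L_p`. (It contains the identity `L_0`.) -/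
def toeplitz {n : ℕ} (Θ : Matrix (Fin n) (Fin n) ℝ) :
    StarSubalgebra ℂ (Ell2 n →L[ℂ] Ell2 n) :=
  (StarAlgebra.adjoin ℂ (Set.range (leftRegular Θ))).topologicalClosure

/-- The generator `L_p` as an element of `T_r(ℕⁿ, σ_Θ)`. -/
def gen {n : ℕ} (Θ : Matrix (Fin n) (Fin n) ℝ) (p : Fin n → ℕ) : toeplitz Θ :=
  ⟨leftRegular Θ p, StarSubalgebra.le_topologicalClosure _
    (StarAlgebra.subset_adjoin ℂ _ ⟨p, rfl⟩)⟩

theorem leftRegular_basisVec {n : ℕ} (Θ : Matrix (Fin n) (Fin n) ℝ) (p q : Fin n → ℕ) :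
    leftRegular Θ p (basisVec q) = (cocycle Θ p q : ℂ) • basisVec (p + q) :=
  monomialIsometry_basisVec _ (add_right_injective p) _ q

theorem star_mul_self_of_isometry {n : ℕ} (V : Ell2 n →ₗᵢ[ℂ] Ell2 n) :
    star V.toContinuousLinearMap * V.toContinuousLinearMap = 1 :=
  (ContinuousLinearMap.norm_map_iff_adjoint_comp_self _).1 V.norm_map

theorem star_gen_mul_gen {n : ℕ} (Θ : Matrix (Fin n) (Fin n) ℝ) (p : Fin n → ℕ) :
    star (gen Θ p) * gen Θ p = 1 :=
  Subtype.ext (star_mul_self_of_isometry _)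

open scoped Classical in
theorem range_proj_basisVec {n : ℕ} (Θ : Matrix (Fin n) (Fin n) ℝ) (p q : Fin n → ℕ) :
    (leftRegular Θ p * star (leftRegular Θ p)) (basisVec q)
      = (if p ≤ q then (1 : ℂ) else 0) • basisVec q := by
  by_cases h : p ≤ q
  · obtain ⟨m, rfl⟩ := exists_add_of_le h
    have h1 : basisVec (p + m)
        = leftRegular Θ p ((starRingEnd ℂ) (cocycle Θ p m : ℂ) • basisVec m) := by
      rw [map_smul, leftRegular_basisVec, smul_smul, ← Complex.normSq_eq_conj_mul_self]
      simp
    have h2 : star (leftRegular Θ p) * leftRegular Θ p = 1 := star_mul_self_of_isometry _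
    rw [if_pos h, one_smul]
    conv_lhs => rw [h1]
    rw [← mul_apply_eq_comp, mul_assoc, h2, mul_one, ← h1]
  · have : (star (leftRegular Θ p)) (basisVec q) = 0 := by
      apply eq_of_inner_basisVec
      intro m
      rw [ContinuousLinearMap.star_eq_adjoint, ContinuousLinearMap.adjoint_inner_right,
        leftRegular_basisVec, inner_smul_left, inner_basisVec, inner_zero_right, if_neg, mul_zero]
      rintro rfl
      exact h (le_add_of_nonneg_right (zero_le))
    rw [if_neg h, zero_smul, mul_apply_eq_comp, this, map_zero]

theorem commute_range_proj {n : ℕ} (Θ : Matrix (Fin n) (Fin n) ℝ) (p q : Fin n → ℕ) :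
    Commute (gen Θ p * star (gen Θ p)) (gen Θ q * star (gen Θ q)) := by
  apply Subtype.ext
  change (leftRegular Θ p * star (leftRegular Θ p)) * (leftRegular Θ q * star (leftRegular Θ q))
    = (leftRegular Θ q * star (leftRegular Θ q)) * (leftRegular Θ p * star (leftRegular Θ p))
  apply clm_ext
  intro m
  rw [mul_apply_eq_comp, range_proj_basisVec, map_smul, range_proj_basisVec,
    mul_apply_eq_comp, range_proj_basisVec, map_smul, range_proj_basisVec, smul_smul,
    smul_smul, mul_comm]

theorem isStarProjection_range_proj {n : ℕ} (Θ : Matrix (Fin n) (Fin n) ℝ) (p : Fin n → ℕ) :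
    IsStarProjection (gen Θ p * star (gen Θ p)) where
  isIdempotentElem := by
    change gen Θ p * star (gen Θ p) * (gen Θ p * star (gen Θ p)) = _
    rw [mul_assoc, ← mul_assoc (star (gen Θ p)), star_gen_mul_gen, one_mul]
  isSelfAdjoint := by
    change star (gen Θ p * star (gen Θ p)) = _
    rw [star_mul, star_star]

/-! ### The dynamics -/

/-- The diagonal isometry `u_t δ_q = exp (i ⟨q, r⟩ t) δ_q`. -/
def diagOp {n : ℕ} (r : Fin n → ℝ) (t : ℝ) : Ell2 n →L[ℂ] Ell2 n :=
  (monomialIsometry id Function.injective_id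
    (fun q => Circle.exp (pairing q r * t))).toContinuousLinearMap

theorem diagOp_basisVec {n : ℕ} (r : Fin n → ℝ) (t : ℝ) (q : Fin n → ℕ) :
    diagOp r t (basisVec q) = (Circle.exp (pairing q r * t) : ℂ) • basisVec q :=
  monomialIsometry_basisVec _ Function.injective_id _ q

theorem diagOp_mul_neg {n : ℕ} (r : Fin n → ℝ) (t : ℝ) : diagOp r t * diagOp r (-t) = 1 := by
  apply clm_ext
  intro q
  rw [mul_apply_eq_comp, diagOp_basisVec, map_smul, diagOp_basisVec, smul_smul,
    ← Circle.coe_mul, ← Circle.exp_add]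
  simp

theorem star_diagOp {n : ℕ} (r : Fin n → ℝ) (t : ℝ) : star (diagOp r t) = diagOp r (-t) := by
  have h : star (diagOp r t) * diagOp r t = 1 := star_mul_self_of_isometry _
  calc star (diagOp r t) = star (diagOp r t) * (diagOp r t * diagOp r (-t)) := by
        rw [diagOp_mul_neg, mul_one]
    _ = diagOp r (-t) := by rw [← mul_assoc, h, one_mul]

/-- The unitary `u_t δ_q = exp (i ⟨q, r⟩ t) δ_q`. -/
def diagUnitary {n : ℕ} (r : Fin n → ℝ) (t : ℝ) : unitary (Ell2 n →L[ℂ] Ell2 n) :=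
  ⟨diagOp r t, Unitary.mem_iff.2 ⟨star_mul_self_of_isometry _, by
    rw [star_diagOp, diagOp_mul_neg]⟩⟩

theorem conj_leftRegular {n : ℕ} (Θ : Matrix (Fin n) (Fin n) ℝ) (r : Fin n → ℝ) (t : ℝ)
    (p : Fin n → ℕ) :
    Unitary.conjStarAlgAut ℂ _ (diagUnitary r t) (leftRegular Θ p)
      = (Circle.exp (pairing p r * t) : ℂ) • leftRegular Θ p := by
  rw [Unitary.conjStarAlgAut_apply]
  change diagOp r t * leftRegular Θ p * star (diagOp r t) = _
  rw [star_diagOp]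
  apply clm_ext
  intro q
  have hp : pairing (p + q) r = pairing p r + pairing q r := by
    simp [pairing, add_mul, Finset.sum_add_distrib]
  rw [mul_apply_eq_comp, mul_apply_eq_comp, diagOp_basisVec, map_smul,
    map_smul, leftRegular_basisVec, map_smul, diagOp_basisVec, FunLike.coe_smul, Pi.smul_apply,
    leftRegular_basisVec, smul_smul, smul_smul, smul_smul]
  congr 1
  rw [mul_right_comm, ← Circle.coe_mul (Circle.exp _) (Circle.exp _), ← Circle.exp_add, hp]
  congr 3
  ring

theorem conj_mem_toeplitz {n : ℕ} (Θ : Matrix (Fin n) (Fin n) ℝ) (r : Fin n → ℝ) (t : ℝ)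
    (a : Ell2 n →L[ℂ] Ell2 n) (ha : a ∈ toeplitz Θ) :
    Unitary.conjStarAlgAut ℂ _ (diagUnitary r t) a ∈ toeplitz Θ := by
  have hcont : Continuous
      (fun a : Ell2 n →L[ℂ] Ell2 n => Unitary.conjStarAlgAut ℂ _ (diagUnitary r t) a) := by
    simp only [Unitary.conjStarAlgAut_apply]
    fun_prop
  have hle : toeplitz Θ ≤ (toeplitz Θ).comap
      (Unitary.conjStarAlgAut ℂ _ (diagUnitary r t) :
        (Ell2 n →L[ℂ] Ell2 n) →⋆ₐ[ℂ] (Ell2 n →L[ℂ] Ell2 n)) := by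
    refine StarSubalgebra.topologicalClosure_minimal ?_ ?_
    · refine StarAlgebra.adjoin_le ?_
      rintro _ ⟨p, rfl⟩
      change Unitary.conjStarAlgAut ℂ _ (diagUnitary r t) (leftRegular Θ p) ∈ toeplitz Θ
      rw [conj_leftRegular]
      exact (toeplitz Θ).smul_mem (gen Θ p).2 _
    · exact (StarSubalgebra.isClosed_topologicalClosure _).preimage hcont
  exact hle ha

/-- The dynamics `α_t = Ad u_t` on `T_r(ℕⁿ, σ_Θ)`, so that `α_t(L_p) = exp (i ⟨p, r⟩ t) L_p`. -/
def dynamics {n : ℕ} (Θ : Matrix (Fin n) (Fin n) ℝ) (r : Fin n → ℝ) (t : ℝ) (a : toeplitz Θ) :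
    toeplitz Θ :=
  ⟨(diagUnitary r t : Ell2 n →L[ℂ] Ell2 n) * a * star (diagUnitary r t : Ell2 n →L[ℂ] Ell2 n),
    conj_mem_toeplitz Θ r t a a.2⟩

theorem dynamics_gen {n : ℕ} (Θ : Matrix (Fin n) (Fin n) ℝ) (r : Fin n → ℝ) (t : ℝ)
    (p : Fin n → ℕ) :
    dynamics Θ r t (gen Θ p) = (Circle.exp (pairing p r * t) : ℂ) • gen Θ p :=
  Subtype.ext (conj_leftRegular Θ r t p)

/-! ### The splitting `ℕⁿ = ℕᵏ × ℕᵈ` -/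

/-- `(p, 0) ∈ ℕᵏ × 0_d`. -/
def inl {k : ℕ} (d : ℕ) (p : Fin k → ℕ) : Fin (k + d) → ℕ := Fin.append p 0

/-- `(0, x) ∈ 0_k × ℕᵈ`. -/
def inr (k : ℕ) {d : ℕ} (x : Fin d → ℕ) : Fin (k + d) → ℕ := Fin.append 0 x

/-- The vector `r = (r_1, …, r_k, 0_d)`. -/
def extendZero {k : ℕ} (d : ℕ) (r : Fin k → ℝ) : Fin (k + d) → ℝ := Fin.append r 0

/-- The lower right `d × d` corner `Θ_d` of `Θ`. -/
def lowerRight {k d : ℕ} (Θ : Matrix (Fin (k + d)) (Fin (k + d)) ℝ) : Matrix (Fin d) (Fin d) ℝ :=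
  Θ.submatrix (Fin.natAdd k) (Fin.natAdd k)

/-- The C*-subalgebra `C*(L_x : x ∈ 0_k × ℕᵈ)` of `T_r(ℕⁿ, σ_Θ)`. -/
def coreAlg {k d : ℕ} (Θ : Matrix (Fin (k + d)) (Fin (k + d)) ℝ) :
    StarSubalgebra ℂ (toeplitz Θ) :=
  (StarAlgebra.adjoin ℂ (Set.range fun x : Fin d → ℕ => gen Θ (inr k x))).topologicalClosure

/-- The generator index `e_j`, for `j ≤ k`. -/
def stdIdx {k : ℕ} (d : ℕ) (j : Fin k) : Fin (k + d) → ℕ := Pi.single (Fin.castAdd d j) 1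

/-- `Q = ∏_{j ≤ k} (1 - L_{e_j} L_{e_j}^*)`, a product of commuting projections. -/
def projQ {k d : ℕ} (Θ : Matrix (Fin (k + d)) (Fin (k + d)) ℝ) : toeplitz Θ :=
  Finset.univ.noncommProd
    (fun j : Fin k => 1 - gen Θ (stdIdx d j) * star (gen Θ (stdIdx d j)))
    (fun _ _ _ _ _ => ((Commute.one_left _).sub_left
      ((Commute.one_right _).sub_right (commute_range_proj Θ _ _))))

theorem isStarProjection_projQ {k d : ℕ} (Θ : Matrix (Fin (k + d)) (Fin (k + d)) ℝ) :
    IsStarProjection (projQ Θ) := by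
  suffices h : ∀ (s : Finset (Fin k)) (hc), IsStarProjection
      (s.noncommProd (fun j : Fin k => 1 - gen Θ (stdIdx d j) * star (gen Θ (stdIdx d j))) hc) from
    h _ _
  intro s
  induction s using Finset.cons_induction with
  | empty => intro _; simp
  | cons a s ha ih =>
    intro hc
    rw [Finset.noncommProd_cons]
    have hcomm : ∀ j : Fin k,
        Commute (1 - gen Θ (stdIdx d a) * star (gen Θ (stdIdx d a)))
          (1 - gen Θ (stdIdx d j) * star (gen Θ (stdIdx d j))) := fun j =>
      (Commute.one_left _).sub_left ((Commute.one_right _).sub_right (commute_range_proj Θ _ _))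
    exact (isStarProjection_range_proj Θ _).one_sub.mul (ih _)
      (Finset.noncommProd_commute _ _ _ _ fun j _ => hcomm j)

/-- The corner `Q T_r(ℕⁿ, σ_Θ) Q`. -/
abbrev cornerQ {k d : ℕ} (Θ : Matrix (Fin (k + d)) (Fin (k + d)) ℝ) :
    NonUnitalStarSubalgebra ℂ (toeplitz Θ) :=
  corner (projQ Θ) (isStarProjection_projQ Θ)

/-- The compression `X ↦ Q X Q` to the corner `Q T_r(ℕⁿ, σ_Θ) Q`. -/
abbrev compressQ {k d : ℕ} (Θ : Matrix (Fin (k + d)) (Fin (k + d)) ℝ) (X : toeplitz Θ) :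
    cornerQ Θ :=
  compress (projQ Θ) (isStarProjection_projQ Θ) X

/-- `Z(β) = ∑_{l ∈ ℕᵏ} exp (-β ⟨l, r⟩)`. -/
def partitionFn {k : ℕ} (r : Fin k → ℝ) (β : ℝ) : ℝ :=
  ∑' l : Fin k → ℕ, Real.exp (-β * pairing l r)

/-- The term with index `l ∈ ℕᵏ` of the series
`T_β(ω)(X) = Z(β)⁻¹ ∑_l exp (-β ⟨l, r⟩) ω(Q L_l^* X L_l Q)`. -/
def seriesTerm {k d : ℕ} (Θ : Matrix (Fin (k + d)) (Fin (k + d)) ℝ) (r : Fin k → ℝ) (β : ℝ)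
    (ω : cornerQ Θ → ℂ) (X : toeplitz Θ) (l : Fin k → ℕ) : ℂ :=
  (((partitionFn r β)⁻¹ * Real.exp (-β * pairing l r) : ℝ) : ℂ) *
    ω (compressQ Θ (star (gen Θ (inl d l)) * X * gen Θ (inl d l)))

/-- The Euler product
`∏_{j ≤ k} exp (-β r_j p_j) (1 - exp (-β r_j)) / (1 - exp (-β r_j + 2 π i ⟨Θ (x - y), e_j⟩))`
for `p ∈ ℕᵏ` and `x, y ∈ ℕᵈ ≅ 0_k × ℕᵈ`. -/
def eulerProduct {k d : ℕ} (Θ : Matrix (Fin (k + d)) (Fin (k + d)) ℝ) (r : Fin k → ℝ) (β : ℝ)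
    (p : Fin k → ℕ) (x y : Fin d → ℕ) : ℂ :=
  ∏ j : Fin k,
    Complex.exp (-β * r j * p j) * (1 - Complex.exp (-β * r j)) /
      (1 - Complex.exp (-β * r j + 2 * Real.pi * Complex.I *
        ((Θ.mulVec (fun i => (inr k x i : ℝ) - (inr k y i : ℝ)) (Fin.castAdd d j) : ℝ) : ℂ)))

end ToeplitzTorus

end

open ToeplitzTorus

/-! The space `ℓ²(ℕⁿ)` is the orthogonal sum of the strips `l × ℕᵈ`, `l ∈ ℕᵏ`, and `W_l = L_l W_0`
(`strip`) is an isometry of `ℓ²(ℕᵈ)` onto the strip `l`. On monomials one checks that `S_l(X) =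
W_l^* X W_l` maps the big algebra into the small one (`compress_monomial`, `stripCompress`). Since
`Q = W_0 W_0^*`, the corner is a copy of the image of `S_0`. On the core, `S_0` is an isomorphism
onto `T_r(ℕᵈ, σ_{Θ_d})`: the right regular isometries commute with the core and carry strip `0` to
every other strip, whence injectivity; the range is closed and contains the generators, whence
surjectivity. Because `S_0(L_l^* X L_l) = S_l(X)`, the series of the theorem is `gibbs`, the average
of `τ ∘ S_l` with the Gibbs weights `w_l = Z(β)⁻¹ exp (-β ⟨l, r⟩)`.

This average is KMS. Left multiplication by `L_p`, `p ∈ ℕᵏ`, shifts the strips, `S_{p+m}(L_p a) =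
S_m(a L_p)`, and the shift of the weights gives the factor `exp (-β ⟨p, r⟩)`; for `L_x`, `x ∈ ℕᵈ`,
the phases on both sides agree and traciality finishes. `mem_kmsStates_of_gen` passes from
generators to all analytic elements. On monomials the series is a product of geometric series, which
yields the Euler product; the span of the monomials is dense, so the formula determines the
functional.

Conversely, let `φ` be KMS. The corner is fixed by the dynamics, so `τ(Y) = Z(β) φ(Q ι(Y) Q)` is a
trace, normalized because `φ(Q) = Z(β)⁻¹` (`kms_projQ`). For `P_l = L_l Q L_l^*` the KMS condition
gives `φ(X P_l) = w_l τ(S_l(X))`. Since the masses `φ(P_l) = w_l` sum to `1`, Cauchy–Schwarz shows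
`φ(X) = ∑ φ(X P_l)`, so `φ` comes from `τ` (`gibbs_coreTrace`). Continuity in both directions is
elementary, the series converging uniformly over states. -/

noncomputable section

namespace ToeplitzTorus

/-! ### Shortcut instances -/

local instance (n : ℕ) : NormedAddCommGroup (Ell2 n) := inferInstance

local instance (n : ℕ) : SeminormedAddCommGroup (Ell2 n) := inferInstance

local instance (n : ℕ) : AddCommGroup (Ell2 n) := inferInstance

local instance (n : ℕ) : AddCommMonoid (Ell2 n) := inferInstance

local instance (n : ℕ) : UniformSpace (Ell2 n) := inferInstance

local instance (n : ℕ) : TopologicalSpace (Ell2 n) := inferInstance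

local instance (n : ℕ) : Module ℂ (Ell2 n) := inferInstance

local instance (n : ℕ) : DistribMulAction ℂ (Ell2 n) := inferInstance

local instance {n : ℕ} (Θ : Matrix (Fin n) (Fin n) ℝ) : NormedRing (toeplitz Θ) :=
  inferInstance

local instance {n : ℕ} (Θ : Matrix (Fin n) (Fin n) ℝ) : SeminormedRing (toeplitz Θ) :=
  inferInstance

local instance {n : ℕ} (Θ : Matrix (Fin n) (Fin n) ℝ) : Ring (toeplitz Θ) := inferInstance

local instance {n : ℕ} (Θ : Matrix (Fin n) (Fin n) ℝ) : Semiring (toeplitz Θ) :=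
  inferInstance

local instance {n : ℕ} (Θ : Matrix (Fin n) (Fin n) ℝ) : NonAssocRing (toeplitz Θ) :=
  inferInstance

local instance {n : ℕ} (Θ : Matrix (Fin n) (Fin n) ℝ) : NonAssocSemiring (toeplitz Θ) :=
  inferInstance

local instance {n : ℕ} (Θ : Matrix (Fin n) (Fin n) ℝ) : NonUnitalNonAssocSemiring (toeplitz Θ) :=
  inferInstance

local instance {n : ℕ} (Θ : Matrix (Fin n) (Fin n) ℝ) : AddCommMonoid (toeplitz Θ) :=
  inferInstance

local instance {n : ℕ} (Θ : Matrix (Fin n) (Fin n) ℝ) : SeminormedAddCommGroup (toeplitz Θ) :=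
  inferInstance

local instance {n : ℕ} (Θ : Matrix (Fin n) (Fin n) ℝ) : TopologicalSpace (toeplitz Θ) :=
  inferInstance

local instance {n : ℕ} (Θ : Matrix (Fin n) (Fin n) ℝ) : Mul (toeplitz Θ) := inferInstance

local instance {n : ℕ} (Θ : Matrix (Fin n) (Fin n) ℝ) : Add (toeplitz Θ) := inferInstance

local instance {n : ℕ} (Θ : Matrix (Fin n) (Fin n) ℝ) : NormedAlgebra ℂ (toeplitz Θ) :=
  inferInstance

local instance {n : ℕ} (Θ : Matrix (Fin n) (Fin n) ℝ) : Algebra ℂ (toeplitz Θ) :=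
  inferInstance

local instance {n : ℕ} (Θ : Matrix (Fin n) (Fin n) ℝ) : Module ℂ (toeplitz Θ) :=
  inferInstance

local instance {n : ℕ} (Θ : Matrix (Fin n) (Fin n) ℝ) : StarRing (toeplitz Θ) :=
  inferInstance

/-! ### The pairing and the cocycle -/

theorem pairing_add_left {n : ℕ} (p q : Fin n → ℕ) (v : Fin n → ℝ) :
    pairing (p + q) v = pairing p v + pairing q v := by
  simp [pairing, add_mul, Finset.sum_add_distrib]

theorem pairing_mulVec_add {n : ℕ} (Θ : Matrix (Fin n) (Fin n) ℝ) (p q m : Fin n → ℕ) :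
    pairing p (Θ.mulVec fun j => ((q + m) j : ℝ))
      = pairing p (Θ.mulVec fun j => (q j : ℝ)) + pairing p (Θ.mulVec fun j => (m j : ℝ)) := by
  have : (fun j => ((q + m) j : ℝ)) = (fun j => (q j : ℝ)) + fun j => (m j : ℝ) := by
    ext; simp
  rw [this]
  simp only [pairing, Matrix.mulVec_add, Pi.add_apply, mul_add, Finset.sum_add_distrib]

theorem pairing_mulVec_swap {n : ℕ} {Θ : Matrix (Fin n) (Fin n) ℝ} (hΘ : Θ.transpose = -Θ)
    (p q : Fin n → ℕ) :
    pairing p (Θ.mulVec fun j => (q j : ℝ)) = -pairing q (Θ.mulVec fun j => (p j : ℝ)) := by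
  have h (u v : Fin n → ℕ) : pairing u (Θ.mulVec fun j => (v j : ℝ))
      = (fun j => (u j : ℝ)) ⬝ᵥ Θ.mulVec fun j => (v j : ℝ) := rfl
  rw [h, h, Matrix.dotProduct_mulVec, ← Matrix.mulVec_transpose, hΘ, Matrix.neg_mulVec,
    neg_dotProduct, dotProduct_comm]

theorem cocycle_add_left {n : ℕ} (Θ : Matrix (Fin n) (Fin n) ℝ) (p q m : Fin n → ℕ) :
    cocycle Θ (p + q) m = cocycle Θ p m * cocycle Θ q m := by
  rw [cocycle, cocycle, cocycle, ← Circle.exp_add, pairing_add_left]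
  ring_nf

theorem cocycle_add_right {n : ℕ} (Θ : Matrix (Fin n) (Fin n) ℝ) (p q m : Fin n → ℕ) :
    cocycle Θ p (q + m) = cocycle Θ p q * cocycle Θ p m := by
  rw [cocycle, cocycle, cocycle, ← Circle.exp_add, pairing_mulVec_add]
  ring_nf

theorem cocycle_swap {n : ℕ} {Θ : Matrix (Fin n) (Fin n) ℝ} (hΘ : Θ.transpose = -Θ)
    (p q : Fin n → ℕ) : cocycle Θ q p = (cocycle Θ p q)⁻¹ := by
  rw [cocycle, cocycle, pairing_mulVec_swap hΘ, ← Circle.exp_neg]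
  ring_nf

theorem cocycle_zero_left {n : ℕ} (Θ : Matrix (Fin n) (Fin n) ℝ) (p : Fin n → ℕ) :
    cocycle Θ 0 p = 1 := by
  simp [cocycle, pairing]

theorem conj_mul_circle (c : Circle) : (starRingEnd ℂ) (c : ℂ) * c = 1 := by
  rw [← Complex.normSq_eq_conj_mul_self]; simp

theorem circle_mul_conj (c : Circle) : (c : ℂ) * (starRingEnd ℂ) (c : ℂ) = 1 := by
  rw [mul_comm, conj_mul_circle]

/-! ### Monomial isometries -/

section Monomial

variable {n : ℕ} (s : (Fin n → ℕ) → (Fin n → ℕ)) (hs : Function.Injective s)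
  (c : (Fin n → ℕ) → Circle)

theorem star_monomial_apply (q : Fin n → ℕ) :
    star (monomialIsometry s hs c).toContinuousLinearMap (basisVec (s q))
      = (starRingEnd ℂ) (c q : ℂ) • basisVec q := by
  apply eq_of_inner_basisVec
  intro m
  rw [ContinuousLinearMap.star_eq_adjoint, ContinuousLinearMap.adjoint_inner_right]
  change inner ℂ (monomialIsometry s hs c (basisVec m)) _ = _
  rw [monomialIsometry_basisVec, inner_smul_left, inner_smul_right, inner_basisVec,
    inner_basisVec]
  by_cases h : m = q
  · subst h; simp
  · simp [h, hs.ne h]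

theorem star_monomial_apply_of_notMem {m : Fin n → ℕ} (hm : ∀ q, s q ≠ m) :
    star (monomialIsometry s hs c).toContinuousLinearMap (basisVec m) = 0 := by
  apply eq_of_inner_basisVec
  intro q
  rw [ContinuousLinearMap.star_eq_adjoint, ContinuousLinearMap.adjoint_inner_right]
  change inner ℂ (monomialIsometry s hs c (basisVec q)) _ = _
  rw [monomialIsometry_basisVec, inner_smul_left, inner_basisVec, if_neg (hm q)]
  simp

end Monomial

/-! ### Relations between the generators -/

variable {n : ℕ} {Θ : Matrix (Fin n) (Fin n) ℝ}

theorem star_leftRegular_apply_add (p q : Fin n → ℕ) :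
    star (leftRegular Θ p) (basisVec (p + q)) = (starRingEnd ℂ) (cocycle Θ p q : ℂ) • basisVec q :=
  star_monomial_apply _ (add_right_injective p) _ q

theorem star_leftRegular_apply_of_not_le {p q : Fin n → ℕ} (h : ¬ p ≤ q) :
    star (leftRegular Θ p) (basisVec q) = 0 :=
  star_monomial_apply_of_notMem _ (add_right_injective p) _ fun _ hm =>
    h (hm ▸ le_add_of_nonneg_right zero_le)

theorem star_mul_leftRegular (p : Fin n → ℕ) : star (leftRegular Θ p) * leftRegular Θ p = 1 :=
  star_mul_self_of_isometry _

theorem leftRegular_mul (p q : Fin n → ℕ) :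
    leftRegular Θ p * leftRegular Θ q = (cocycle Θ p q : ℂ) • leftRegular Θ (p + q) := by
  apply clm_ext
  intro m
  rw [mul_apply_eq_comp, leftRegular_basisVec, map_smul, leftRegular_basisVec,
    FunLike.coe_smul, Pi.smul_apply, leftRegular_basisVec, smul_smul, smul_smul,
    cocycle_add_left, cocycle_add_right, add_assoc]
  congr 1
  push_cast
  ring

theorem leftRegular_add (p q : Fin n → ℕ) :
    leftRegular Θ (p + q)
      = (starRingEnd ℂ) (cocycle Θ p q : ℂ) • (leftRegular Θ p * leftRegular Θ q) := by
  rw [leftRegular_mul, smul_smul, conj_mul_circle, one_smul]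

theorem leftRegular_zero : leftRegular Θ 0 = 1 := by
  apply clm_ext
  intro m
  rw [leftRegular_basisVec, cocycle_zero_left]
  simp

/-- The square arises because antisymmetry makes `σ(q, p)` the inverse of `σ(p, q)`. -/
theorem leftRegular_mul_comm (hΘ : Θ.transpose = -Θ) (p q : Fin n → ℕ) :
    leftRegular Θ p * leftRegular Θ q
      = ((cocycle Θ p q ^ 2 : Circle) : ℂ) • (leftRegular Θ q * leftRegular Θ p) := by
  rw [leftRegular_mul, leftRegular_mul, smul_smul, cocycle_swap hΘ p q, add_comm q p,
    ← Circle.coe_mul]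
  congr 2
  rw [pow_two, mul_assoc, mul_inv_cancel, mul_one]

/-- Two multi-indices with disjoint supports. -/
def DisjSupp (p q : Fin n → ℕ) : Prop := ∀ j, p j = 0 ∨ q j = 0

theorem DisjSupp.symm {p q : Fin n → ℕ} (h : DisjSupp p q) : DisjSupp q p := fun j => (h j).symm

theorem DisjSupp.le_of_le_add {p q m : Fin n → ℕ} (h : DisjSupp p q) (hle : p ≤ q + m) :
    p ≤ m := by
  intro j
  rcases h j with hj | hj
  · rw [hj]; exact Nat.zero_le _
  · have := hle j
    rw [Pi.add_apply, hj, zero_add] at this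
    exact this

/-- For disjoint supports `p ≤ q + m` forces `p ≤ m`, so both sides kill the same basis vectors; on
the others only the phases have to be compared. -/
theorem star_leftRegular_mul (hΘ : Θ.transpose = -Θ) {p q : Fin n → ℕ} (h : DisjSupp p q) :
    star (leftRegular Θ p) * leftRegular Θ q
      = ((cocycle Θ q p ^ 2 : Circle) : ℂ) • (leftRegular Θ q * star (leftRegular Θ p)) := by
  apply clm_ext
  intro m
  rw [FunLike.coe_smul, Pi.smul_apply, mul_apply_eq_comp, mul_apply_eq_comp]
  by_cases hm : p ≤ m
  · obtain ⟨m, rfl⟩ := exists_add_of_le hm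
    rw [leftRegular_basisVec, map_smul, add_left_comm, star_leftRegular_apply_add,
      star_leftRegular_apply_add, map_smul, leftRegular_basisVec, smul_smul, smul_smul, smul_smul,
      cocycle_add_right, cocycle_add_right]
    congr 1
    rw [cocycle_swap hΘ q p, ← Circle.coe_inv_eq_conj, ← Circle.coe_inv_eq_conj]
    simp only [← Circle.coe_mul]
    congr 1
    rw [mul_inv, inv_inv, pow_two]
    ac_rfl
  · rw [star_leftRegular_apply_of_not_le hm, leftRegular_basisVec, map_smul,
      star_leftRegular_apply_of_not_le fun h' => hm (h.le_of_le_add h')]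
    simp

/-! ### The right regular representation -/

/-- The isometry `R_l δ_q = σ_Θ(q, l) δ_{q+l}` of the right regular `σ_Θ`-representation. -/
def rightRegular (Θ : Matrix (Fin n) (Fin n) ℝ) (l : Fin n → ℕ) : Ell2 n →L[ℂ] Ell2 n :=
  (monomialIsometry (fun q => l + q) (add_right_injective l)
    (fun q => cocycle Θ q l)).toContinuousLinearMap

theorem rightRegular_basisVec (l q : Fin n → ℕ) :
    rightRegular Θ l (basisVec q) = (cocycle Θ q l : ℂ) • basisVec (l + q) :=
  monomialIsometry_basisVec _ (add_right_injective l) _ q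

theorem star_rightRegular_apply_add (p q : Fin n → ℕ) :
    star (rightRegular Θ p) (basisVec (p + q))
      = (starRingEnd ℂ) (cocycle Θ q p : ℂ) • basisVec q :=
  star_monomial_apply _ (add_right_injective p) _ q

theorem star_rightRegular_apply_of_not_le {p q : Fin n → ℕ} (h : ¬ p ≤ q) :
    star (rightRegular Θ p) (basisVec q) = 0 :=
  star_monomial_apply_of_notMem _ (add_right_injective p) _ fun _ hm =>
    h (hm ▸ le_add_of_nonneg_right zero_le)

/-- By bimultiplicativity of the cocycle, both orders give `δ_m` the phase `σ(p, m) σ(p, l) σ(m,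
l)`. -/
theorem rightRegular_mul_leftRegular (l p : Fin n → ℕ) :
    rightRegular Θ l * leftRegular Θ p = leftRegular Θ p * rightRegular Θ l := by
  apply clm_ext
  intro m
  rw [mul_apply_eq_comp, mul_apply_eq_comp, leftRegular_basisVec, map_smul,
    rightRegular_basisVec, rightRegular_basisVec, map_smul, leftRegular_basisVec, smul_smul,
    smul_smul, cocycle_add_left, cocycle_add_right, add_left_comm]
  congr 1
  push_cast
  ring

/-- Needed besides the previous commutation because commuting with a generated C*-algebra requires
commutation of both `R_l` and `R_l^*` with its generators. -/
theorem star_rightRegular_mul_leftRegular {l p : Fin n → ℕ} (h : DisjSupp l p) :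
    star (rightRegular Θ l) * leftRegular Θ p = leftRegular Θ p * star (rightRegular Θ l) := by
  apply clm_ext
  intro m
  rw [mul_apply_eq_comp, mul_apply_eq_comp]
  by_cases hm : l ≤ m
  · obtain ⟨m, rfl⟩ := exists_add_of_le hm
    rw [leftRegular_basisVec, map_smul, add_left_comm, star_rightRegular_apply_add,
      star_rightRegular_apply_add, map_smul, leftRegular_basisVec, smul_smul, smul_smul,
      cocycle_add_left, cocycle_add_right, add_comm p m]
    congr 1
    have := circle_mul_conj (cocycle Θ p l)
    push_cast
    rw [map_mul]
    linear_combination (cocycle Θ p m : ℂ) * (starRingEnd ℂ) (cocycle Θ m l : ℂ) * this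
  · rw [star_rightRegular_apply_of_not_le hm, leftRegular_basisVec, map_smul,
      star_rightRegular_apply_of_not_le fun h' => hm (h.le_of_le_add h')]
    simp

/-! ### Linear spanning by the operators `L_p L_q^*` -/

section Span

variable {n : ℕ} {Θ : Matrix (Fin n) (Fin n) ℝ}

/-- The common part `q ⊓ a` cancels by `L_m^* L_m = 1`; the remainders have disjoint supports, so
the adjoint can be moved to the right. This makes the span of the `L_p L_q^*` closed under products.
-/
theorem star_leftRegular_mul_eq (hΘ : Θ.transpose = -Θ) (q a : Fin n → ℕ) :
    ∃ (c : ℂ) (a' q' : Fin n → ℕ), star (leftRegular Θ q) * leftRegular Θ a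
      = c • (leftRegular Θ a' * star (leftRegular Θ q')) := by
  have hq : q ⊓ a + (q - q ⊓ a) = q := add_tsub_cancel_of_le inf_le_left
  have ha : q ⊓ a + (a - q ⊓ a) = a := add_tsub_cancel_of_le inf_le_right
  have hd : DisjSupp (q - q ⊓ a) (a - q ⊓ a) := by
    intro j
    simp only [Pi.sub_apply, Pi.inf_apply]
    omega
  generalize q ⊓ a = m at *
  generalize q - m = q' at *
  generalize a - m = a' at *
  subst hq ha
  rw [leftRegular_add, leftRegular_add, star_smul, star_mul, smul_mul_smul_comm, mul_assoc,
    ← mul_assoc (star (leftRegular Θ m)), star_mul_leftRegular, one_mul,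
    star_leftRegular_mul hΘ hd, smul_smul]
  exact ⟨_, a', q', rfl⟩

/-- The linear span of the operators `L_p L_q^*`, which is a star-subalgebra. -/
def monomialAlg (hΘ : Θ.transpose = -Θ) : StarSubalgebra ℂ (Ell2 n →L[ℂ] Ell2 n) :=
  { Submodule.toSubalgebra
      (Submodule.span ℂ (Set.range fun p : (Fin n → ℕ) × (Fin n → ℕ) =>
        leftRegular Θ p.1 * star (leftRegular Θ p.2)))
      (Submodule.subset_span ⟨(0, 0), by simp [leftRegular_zero]⟩)
      (fun X Y hX hY => by
        induction hX, hY using Submodule.span_induction₂ with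
        | mem_mem X Y hX hY =>
          obtain ⟨⟨p, q⟩, rfl⟩ := hX
          obtain ⟨⟨a, b⟩, rfl⟩ := hY
          obtain ⟨c, a', q', h⟩ := star_leftRegular_mul_eq hΘ q a
          dsimp only
          have : leftRegular Θ p * star (leftRegular Θ q)
              * (leftRegular Θ a * star (leftRegular Θ b))
              = c • ((leftRegular Θ p * leftRegular Θ a')
                * star (leftRegular Θ b * leftRegular Θ q')) := by
            rw [mul_assoc, ← mul_assoc (star (leftRegular Θ q)), h, star_mul, smul_mul_assoc,
              mul_smul_comm]
            simp only [mul_assoc]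
          rw [this, leftRegular_mul, leftRegular_mul, star_smul, smul_mul_smul_comm]
          exact Submodule.smul_mem _ _ (Submodule.smul_mem _ _
            (Submodule.subset_span ⟨(_, _), rfl⟩))
        | zero_left Y _ => rw [zero_mul]; exact zero_mem _
        | zero_right X _ => rw [mul_zero]; exact zero_mem _
        | add_left X X' Y _ _ _ h h' => rw [add_mul]; exact add_mem h h'
        | add_right X Y Y' _ _ _ h h' => rw [mul_add]; exact add_mem h h'
        | smul_left c X Y _ _ h => rw [smul_mul_assoc]; exact Submodule.smul_mem _ _ h
        | smul_right c X Y _ _ h => rw [mul_smul_comm]; exact Submodule.smul_mem _ _ h) with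
    star_mem' := by
      intro X hX
      change X ∈ Submodule.span ℂ _ at hX
      change star X ∈ Submodule.span ℂ _
      induction hX using Submodule.span_induction with
      | mem X hX =>
        obtain ⟨⟨p, q⟩, rfl⟩ := hX
        exact Submodule.subset_span ⟨(q, p), by simp⟩
      | zero => rw [star_zero]; exact zero_mem _
      | add X Y _ _ h h' => rw [star_add]; exact add_mem h h'
      | smul c X _ h => rw [star_smul]; exact Submodule.smul_mem _ _ h }

/-- A closed linear condition holds on `T_r(ℕⁿ, σ_Θ)` if it holds for all `L_p L_q^*`. -/
theorem toeplitz_induction (hΘ : Θ.transpose = -Θ) {P : (Ell2 n →L[ℂ] Ell2 n) → Prop}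
    (closed : IsClosed {X | P X}) (add : ∀ X Y, P X → P Y → P (X + Y))
    (smul : ∀ (c : ℂ) X, P X → P (c • X))
    (monomial : ∀ p q, P (leftRegular Θ p * star (leftRegular Θ q)))
    {X : Ell2 n →L[ℂ] Ell2 n} (hX : X ∈ toeplitz Θ) : P X := by
  have h1 : StarAlgebra.adjoin ℂ (Set.range (leftRegular Θ)) ≤ monomialAlg hΘ := by
    refine StarAlgebra.adjoin_le ?_
    rintro _ ⟨p, rfl⟩
    exact Submodule.subset_span ⟨(p, 0), by simp [leftRegular_zero]⟩
  have h2 : ∀ Y ∈ monomialAlg hΘ, P Y := by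
    intro Y hY
    change Y ∈ Submodule.span ℂ _ at hY
    induction hY using Submodule.span_induction with
    | mem X hX => obtain ⟨⟨p, q⟩, rfl⟩ := hX; exact monomial p q
    | zero => simpa using smul 0 _ (monomial 0 0)
    | add X Y _ _ h h' => exact add _ _ h h'
    | smul c X _ h => exact smul _ _ h
  exact closure_minimal (fun Y hY => h2 Y (h1 hY)) closed hX

end Span

/-! ### The splitting of multi-indices -/

section Split

variable {k d : ℕ}

theorem inl_castAdd (p : Fin k → ℕ) (j : Fin k) : inl d p (Fin.castAdd d j) = p j :=
  Fin.append_left _ _ _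

theorem inl_natAdd (p : Fin k → ℕ) (j : Fin d) : inl d p (Fin.natAdd k j) = 0 :=
  Fin.append_right _ _ _

theorem inr_castAdd (x : Fin d → ℕ) (j : Fin k) : inr k x (Fin.castAdd d j) = 0 :=
  Fin.append_left _ _ _

theorem inr_natAdd (x : Fin d → ℕ) (j : Fin d) : inr k x (Fin.natAdd k j) = x j :=
  Fin.append_right _ _ _

theorem splitIdx_ext {p q : Fin (k + d) → ℕ} (h1 : ∀ j, p (Fin.castAdd d j) = q (Fin.castAdd d j))
    (h2 : ∀ j, p (Fin.natAdd k j) = q (Fin.natAdd k j)) : p = q := by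
  ext i
  induction i using Fin.addCases with
  | left j => exact h1 j
  | right j => exact h2 j

theorem inl_add (p q : Fin k → ℕ) : inl d (p + q) = inl d p + inl d q :=
  splitIdx_ext (fun j => by simp [inl_castAdd]) fun j => by simp [inl_natAdd]

theorem inr_add (x y : Fin d → ℕ) : inr k (x + y) = inr k x + inr k y :=
  splitIdx_ext (fun j => by simp [inr_castAdd]) fun j => by simp [inr_natAdd]

theorem inl_zero : inl d (0 : Fin k → ℕ) = 0 :=
  splitIdx_ext (fun j => by simp [inl_castAdd]) fun j => by simp [inl_natAdd]

theorem inr_zero : inr k (0 : Fin d → ℕ) = 0 :=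
  splitIdx_ext (fun j => by simp [inr_castAdd]) fun j => by simp [inr_natAdd]

theorem exists_eq_inl_add_inr (m : Fin (k + d) → ℕ) :
    ∃ (l : Fin k → ℕ) (x : Fin d → ℕ), m = inl d l + inr k x :=
  ⟨fun j => m (Fin.castAdd d j), fun j => m (Fin.natAdd k j),
    splitIdx_ext (fun j => by simp [inl_castAdd, inr_castAdd])
      fun j => by simp [inl_natAdd, inr_natAdd]⟩

theorem inl_add_inr_inj {l l' : Fin k → ℕ} {x x' : Fin d → ℕ} :
    inl d l + inr k x = inl d l' + inr k x' ↔ l = l' ∧ x = x' := by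
  refine ⟨fun h => ⟨?_, ?_⟩, by rintro ⟨rfl, rfl⟩; rfl⟩
  · ext j
    simpa [inl_castAdd, inr_castAdd] using congrFun h (Fin.castAdd d j)
  · ext j
    simpa [inl_natAdd, inr_natAdd] using congrFun h (Fin.natAdd k j)

theorem inl_le_inl_add_inr {p l : Fin k → ℕ} {x : Fin d → ℕ} :
    inl d p ≤ inl d l + inr k x ↔ p ≤ l := by
  refine ⟨fun h j => ?_, fun h i => ?_⟩
  · simpa [inl_castAdd, inr_castAdd] using h (Fin.castAdd d j)
  · induction i using Fin.addCases with
    | left j => simpa [inl_castAdd, inr_castAdd] using h j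
    | right j => simp [inl_natAdd]

theorem disjSupp_inl_inr (l : Fin k → ℕ) (x : Fin d → ℕ) : DisjSupp (inl d l) (inr k x) := by
  intro i
  induction i using Fin.addCases with
  | left j => exact Or.inr (inr_castAdd x j)
  | right j => exact Or.inl (inl_natAdd l j)

theorem cocycle_inr (Θ : Matrix (Fin (k + d)) (Fin (k + d)) ℝ) (x y : Fin d → ℕ) :
    cocycle Θ (inr k x) (inr k y) = cocycle (lowerRight Θ) x y := by
  have h (f : Fin (k + d) → ℝ) : pairing (inr k x) f = pairing x fun j => f (Fin.natAdd k j) := by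
    rw [pairing, Fin.sum_univ_add]
    simp [inr_castAdd, inr_natAdd, pairing]
  have h' (i : Fin (k + d)) : Θ.mulVec (fun j => (inr k y j : ℝ)) i
      = ∑ j, Θ i (Fin.natAdd k j) * y j := by
    rw [Matrix.mulVec, dotProduct, Fin.sum_univ_add]
    simp [inr_castAdd, inr_natAdd]
  rw [cocycle, cocycle, h]
  simp only [h']
  rfl

end Split

/-! ### The strips `ℓ²(l × ℕᵈ)` -/

section Strip

variable {k d : ℕ} (Θ : Matrix (Fin (k + d)) (Fin (k + d)) ℝ)

theorem orthonormal_basisVec_inr : Orthonormal ℂ (fun q : Fin d → ℕ => basisVec (inr k q)) := by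
  rw [orthonormal_iff_ite]
  intro p q
  rw [inner_basisVec]
  congr 1
  have := inl_add_inr_inj (l := (0 : Fin k → ℕ)) (l' := 0) (x := p) (x' := q)
  simpa [inl_zero] using this

/-- The isometry `ℓ²(ℕᵈ) → ℓ²(ℕⁿ)` with `δ_q ↦ δ_{(0, q)}`. -/
def coreIncl (k d : ℕ) : Ell2 d →L[ℂ] Ell2 (k + d) :=
  ((orthonormal_basisVec_inr (k := k)).orthogonalFamily.linearIsometry).toContinuousLinearMap

theorem coreIncl_basisVec (q : Fin d → ℕ) : coreIncl k d (basisVec q) = basisVec (inr k q) := by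
  change (orthonormal_basisVec_inr (k := k)).orthogonalFamily.linearIsometry (basisVec q) = _
  conv_lhs => rw [basisVec]
  rw [OrthogonalFamily.linearIsometry_apply_single]
  simp

theorem norm_coreIncl_le : ‖coreIncl k d‖ ≤ 1 :=
  LinearIsometry.norm_toContinuousLinearMap_le _

/-- The isometry of `ℓ²(ℕᵈ)` onto the strip with index `l`, namely `L_l` restricted to the strip
with index `0`. -/
def strip (l : Fin k → ℕ) : Ell2 d →L[ℂ] Ell2 (k + d) := leftRegular Θ (inl d l) ∘L coreIncl k d

theorem strip_basisVec (l : Fin k → ℕ) (q : Fin d → ℕ) :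
    strip Θ l (basisVec q) = (cocycle Θ (inl d l) (inr k q) : ℂ) • basisVec (inl d l + inr k q) := by
  rw [strip, ContinuousLinearMap.comp_apply, coreIncl_basisVec, leftRegular_basisVec]

theorem strip_zero : strip Θ 0 = coreIncl k d := by
  rw [strip, inl_zero, leftRegular_zero]
  rfl

theorem clm_ext_strip {m : ℕ} {S T : Ell2 d →L[ℂ] Ell2 m}
    (h : ∀ q, S (basisVec q) = T (basisVec q)) : S = T := by
  refine lp.ext_continuousLinearMap (by simp) fun q => ?_
  ext1
  exact h q

variable {Θ}

theorem star_leftRegular_comp_strip_of_not_le {p l : Fin k → ℕ} (h : ¬ p ≤ l) :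
    star (leftRegular Θ (inl d p)) ∘L strip Θ l = 0 := by
  apply clm_ext_strip
  intro q
  rw [ContinuousLinearMap.comp_apply, strip_basisVec, map_smul,
    star_leftRegular_apply_of_not_le (mt inl_le_inl_add_inr.1 h)]
  simp

theorem leftRegular_comp_strip (p m : Fin k → ℕ) :
    leftRegular Θ (inl d p) ∘L strip Θ m
      = (cocycle Θ (inl d p) (inl d m) : ℂ) • strip Θ (p + m) := by
  rw [strip, strip, ← ContinuousLinearMap.comp_assoc, ← ContinuousLinearMap.mul_def,
    leftRegular_mul, inl_add, ContinuousLinearMap.smul_comp]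

theorem star_leftRegular_comp_strip_add (p m : Fin k → ℕ) :
    star (leftRegular Θ (inl d p)) ∘L strip Θ (p + m)
      = (starRingEnd ℂ) (cocycle Θ (inl d p) (inl d m) : ℂ) • strip Θ m := by
  have h : strip Θ (p + m) = (starRingEnd ℂ) (cocycle Θ (inl d p) (inl d m) : ℂ) •
      (leftRegular Θ (inl d p) ∘L strip Θ m) := by
    rw [leftRegular_comp_strip, smul_smul, conj_mul_circle, one_smul]
  rw [h, ContinuousLinearMap.comp_smul, ← ContinuousLinearMap.comp_assoc,
    ← ContinuousLinearMap.mul_def, star_mul_leftRegular]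
  rfl

theorem leftRegular_inr_comp_coreIncl (x : Fin d → ℕ) :
    leftRegular Θ (inr k x) ∘L coreIncl k d = coreIncl k d ∘L leftRegular (lowerRight Θ) x := by
  apply clm_ext_strip
  intro q
  rw [ContinuousLinearMap.comp_apply, ContinuousLinearMap.comp_apply, coreIncl_basisVec,
    leftRegular_basisVec, leftRegular_basisVec, map_smul, coreIncl_basisVec, cocycle_inr, inr_add]

theorem star_leftRegular_inr_comp_coreIncl (x : Fin d → ℕ) :
    star (leftRegular Θ (inr k x)) ∘L coreIncl k d
      = coreIncl k d ∘L star (leftRegular (lowerRight Θ) x) := by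
  apply clm_ext_strip
  intro q
  rw [ContinuousLinearMap.comp_apply, ContinuousLinearMap.comp_apply, coreIncl_basisVec]
  by_cases h : x ≤ q
  · obtain ⟨q, rfl⟩ := exists_add_of_le h
    rw [inr_add, star_leftRegular_apply_add, star_leftRegular_apply_add, map_smul,
      coreIncl_basisVec, cocycle_inr]
  · rw [star_leftRegular_apply_of_not_le h, map_zero, star_leftRegular_apply_of_not_le]
    intro h'
    exact h fun j => by simpa [inr_natAdd] using h' (Fin.natAdd k j)

/-- `L_x` leaves strip `0` invariant; the phase on strip `l` is the price for commuting `L_x` past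
`L_l`. -/
theorem leftRegular_inr_comp_strip (hΘ : Θ.transpose = -Θ) (x : Fin d → ℕ) (l : Fin k → ℕ) :
    leftRegular Θ (inr k x) ∘L strip Θ l
      = ((cocycle Θ (inr k x) (inl d l) ^ 2 : Circle) : ℂ) •
        (strip Θ l ∘L leftRegular (lowerRight Θ) x) := by
  rw [strip, ← ContinuousLinearMap.comp_assoc, ← ContinuousLinearMap.mul_def,
    leftRegular_mul_comm hΘ, ContinuousLinearMap.smul_comp, ContinuousLinearMap.mul_def,
    ContinuousLinearMap.comp_assoc, leftRegular_inr_comp_coreIncl]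
  rfl

theorem star_leftRegular_inr_comp_strip (hΘ : Θ.transpose = -Θ) (x : Fin d → ℕ)
    (l : Fin k → ℕ) :
    star (leftRegular Θ (inr k x)) ∘L strip Θ l
      = (starRingEnd ℂ) ((cocycle Θ (inr k x) (inl d l) ^ 2 : Circle) : ℂ) •
        (strip Θ l ∘L star (leftRegular (lowerRight Θ) x)) := by
  rw [strip, ← ContinuousLinearMap.comp_assoc, ← ContinuousLinearMap.mul_def,
    star_leftRegular_mul hΘ (disjSupp_inl_inr l x).symm, ContinuousLinearMap.smul_comp,
    ContinuousLinearMap.mul_def, ContinuousLinearMap.comp_assoc,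
    star_leftRegular_inr_comp_coreIncl, cocycle_swap hΘ (inr k x), inv_pow,
    Circle.coe_inv_eq_conj]
  rfl

open ContinuousLinearMap in
theorem adjoint_strip_comp_strip (l m : Fin k → ℕ) :
    adjoint (strip Θ l) ∘L strip Θ m = if l = m then 1 else 0 := by
  apply clm_ext_strip
  intro q
  apply eq_of_inner_basisVec
  intro q'
  rw [comp_apply, adjoint_inner_right, strip_basisVec, strip_basisVec, inner_smul_left,
    inner_smul_right, inner_basisVec]
  simp only [inl_add_inr_inj]
  by_cases h : l = m
  · subst h
    rw [if_pos rfl, one_apply_eq_self, inner_basisVec]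
    by_cases h' : q' = q
    · subst h'
      simp [conj_mul_circle]
    · simp [h']
  · simp [h]

end Strip

theorem isClosed_toeplitz {n : ℕ} (Θ : Matrix (Fin n) (Fin n) ℝ) :
    IsClosed (toeplitz Θ : Set (Ell2 n →L[ℂ] Ell2 n)) :=
  StarSubalgebra.isClosed_topologicalClosure _

theorem isClosed_coreAlg {k d : ℕ} (Θ : Matrix (Fin (k + d)) (Fin (k + d)) ℝ) :
    IsClosed (coreAlg Θ : Set (toeplitz Θ)) :=
  StarSubalgebra.isClosed_topologicalClosure _

section

variable {k d : ℕ} {Θ : Matrix (Fin (k + d)) (Fin (k + d)) ℝ}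

open ContinuousLinearMap

/-! ### Compression to a strip -/

/-- The phase in `W_m^* L_x L_y^* W_m = phase • L_x L_y^*`, for the strip isometry `W_m`. -/
def stripPhase (Θ : Matrix (Fin (k + d)) (Fin (k + d)) ℝ) (x y : Fin d → ℕ) (m : Fin k → ℕ) : ℂ :=
  (starRingEnd ℂ) ((cocycle Θ (inr k y) (inl d m) ^ 2 : Circle) : ℂ)
    * ((cocycle Θ (inr k x) (inl d m) ^ 2 : Circle) : ℂ)

theorem leftRegular_mul_star_comp_strip (hΘ : Θ.transpose = -Θ) (x y : Fin d → ℕ)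
    (m : Fin k → ℕ) :
    (leftRegular Θ (inr k x) * star (leftRegular Θ (inr k y))) ∘L strip Θ m
      = stripPhase Θ x y m • (strip Θ m ∘L
        (leftRegular (lowerRight Θ) x * star (leftRegular (lowerRight Θ) y))) := by
  rw [mul_def, comp_assoc, star_leftRegular_inr_comp_strip hΘ, comp_smul, ← comp_assoc,
    leftRegular_inr_comp_strip hΘ, smul_comp, smul_smul]
  rfl

/-- Makes both outer factors act on the strip through their adjoints, where `L_p^*` simply lowers
the strip index. -/
theorem compress_mul_mul_star (l : Fin k → ℕ) (A B C : Ell2 (k + d) →L[ℂ] Ell2 (k + d)) :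
    adjoint (strip Θ l) ∘L (A * B * star C) ∘L strip Θ l
      = adjoint (star A ∘L strip Θ l) ∘L B ∘L (star C ∘L strip Θ l) := by
  rw [adjoint_comp, ← star_eq_adjoint (star A), star_star]
  rfl

open scoped Classical in
-- `L_p^*` sends strip `l` to strip `l - p`, or to zero if `p ≤ l` fails. Strips are mutually
-- orthogonal, so only `l - p = l - q` survives; then the phases from `L_p` and `L_q` cancel and the
-- middle factor contributes `stripPhase`.
theorem compress_monomial (hΘ : Θ.transpose = -Θ) (l p q : Fin k → ℕ) (x y : Fin d → ℕ) :
    adjoint (strip Θ l) ∘L (leftRegular Θ (inl d p) *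
        (leftRegular Θ (inr k x) * star (leftRegular Θ (inr k y))) *
        star (leftRegular Θ (inl d q))) ∘L strip Θ l
      = (if p = q ∧ p ≤ l then stripPhase Θ x y (l - p) else 0) •
        (leftRegular (lowerRight Θ) x * star (leftRegular (lowerRight Θ) y)) := by
  rw [compress_mul_mul_star]
  by_cases hp : p ≤ l
  · by_cases hq : q ≤ l
    · obtain ⟨m, rfl⟩ := exists_add_of_le hp
      obtain ⟨m', hm⟩ := exists_add_of_le hq
      conv_lhs => rw [star_leftRegular_comp_strip_add, hm, star_leftRegular_comp_strip_add]
      rw [comp_smul, comp_smul, leftRegular_mul_star_comp_strip hΘ, map_smulₛₗ, smul_comp,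
        comp_smul, ← comp_assoc, adjoint_strip_comp_strip]
      by_cases h : p = q
      · subst h
        obtain rfl : m = m' := add_left_cancel hm
        rw [if_pos rfl, if_pos ⟨rfl, hp⟩, add_tsub_cancel_left, smul_smul, smul_smul,
          Complex.conj_conj, conj_mul_circle, one_mul]
        rfl
      · have hmm : m ≠ m' := by
          rintro rfl
          exact h (add_right_cancel hm)
        rw [if_neg hmm, if_neg fun h' : p = q ∧ _ => h h'.1]
        simp
    · rw [star_leftRegular_comp_strip_of_not_le hq, if_neg fun h : p = q ∧ p ≤ l => hq (h.1 ▸ h.2)]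
      simp
  · rw [star_leftRegular_comp_strip_of_not_le hp, if_neg fun h => hp h.2]
    simp

theorem compress_mem_toeplitz (hΘ : Θ.transpose = -Θ) (l : Fin k → ℕ)
    {X : Ell2 (k + d) →L[ℂ] Ell2 (k + d)} (hX : X ∈ toeplitz Θ) :
    adjoint (strip Θ l) ∘L X ∘L strip Θ l ∈ toeplitz (lowerRight Θ) := by
  classical
  refine toeplitz_induction hΘ (P := fun X => adjoint (strip Θ l) ∘L X ∘L strip Θ l ∈
    toeplitz (lowerRight Θ)) ?_ ?_ ?_ ?_ hX
  · exact (isClosed_toeplitz (lowerRight Θ)).preimage (by fun_prop)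
  · intro X Y hX hY
    rw [add_comp, comp_add]
    exact add_mem hX hY
  · intro c X hX
    rw [smul_comp, comp_smul]
    exact (toeplitz _).smul_mem hX c
  · intro p q
    obtain ⟨p, x, rfl⟩ := exists_eq_inl_add_inr p
    obtain ⟨q, y, rfl⟩ := exists_eq_inl_add_inr q
    have : leftRegular Θ (inl d p) * leftRegular Θ (inr k x) *
        star (leftRegular Θ (inl d q) * leftRegular Θ (inr k y)) = leftRegular Θ (inl d p) *
        (leftRegular Θ (inr k x) * star (leftRegular Θ (inr k y))) *
        star (leftRegular Θ (inl d q)) := by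
      rw [star_mul]
      simp only [mul_assoc]
    rw [leftRegular_add, leftRegular_add, star_smul, smul_mul_smul_comm, this, smul_comp, comp_smul,
      compress_monomial hΘ]
    exact (toeplitz _).smul_mem ((toeplitz _).smul_mem
      (gen (lowerRight Θ) x * star (gen (lowerRight Θ) y)).2 _) _

theorem norm_strip_le (l : Fin k → ℕ) : ‖strip Θ l‖ ≤ 1 := by
  refine (opNorm_comp_le _ _).trans ?_
  exact mul_le_one₀ (LinearIsometry.norm_toContinuousLinearMap_le _) (norm_nonneg _)
    norm_coreIncl_le

/-- The compression `X ↦ W_l^* X W_l` to the strip with index `l`. -/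
def stripCompress (hΘ : Θ.transpose = -Θ) (l : Fin k → ℕ) :
    toeplitz Θ →L[ℂ] toeplitz (lowerRight Θ) :=
  LinearMap.mkContinuous
    { toFun := fun X => ⟨adjoint (strip Θ l) ∘L (X : Ell2 (k + d) →L[ℂ] Ell2 (k + d)) ∘L strip Θ l,
        compress_mem_toeplitz hΘ l X.2⟩
      map_add' := fun X Y => Subtype.ext (by
        change adjoint (strip Θ l) ∘L ((X : Ell2 (k + d) →L[ℂ] Ell2 (k + d)) + (Y : Ell2 (k + d) →L[ℂ] Ell2 (k + d))) ∘L strip Θ l = _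
        rw [add_comp, comp_add]
        rfl)
      map_smul' := fun c X => Subtype.ext (by
        change adjoint (strip Θ l) ∘L (c • (X : Ell2 (k + d) →L[ℂ] Ell2 (k + d))) ∘L strip Θ l = _
        rw [smul_comp, comp_smul]
        rfl) } 1 (fun X => by
      change ‖adjoint (strip Θ l) ∘L (X : Ell2 (k + d) →L[ℂ] Ell2 (k + d)) ∘L strip Θ l‖
        ≤ 1 * ‖(X : Ell2 (k + d) →L[ℂ] Ell2 (k + d))‖
      have h := norm_strip_le (Θ := Θ) l
      refine (opNorm_comp_le _ _).trans (mul_le_mul ?_ ?_ (norm_nonneg _) zero_le_one)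
      · rwa [LinearIsometryEquiv.norm_map]
      · exact (opNorm_comp_le _ _).trans (mul_le_of_le_one_right (norm_nonneg _) h))

theorem coe_stripCompress (hΘ : Θ.transpose = -Θ) (l : Fin k → ℕ) (X : toeplitz Θ) :
    (stripCompress hΘ l X : Ell2 d →L[ℂ] Ell2 d)
      = adjoint (strip Θ l) ∘L (X : Ell2 (k + d) →L[ℂ] Ell2 (k + d)) ∘L strip Θ l :=
  rfl

theorem norm_stripCompress_le (hΘ : Θ.transpose = -Θ) (l : Fin k → ℕ) :
    ‖stripCompress hΘ l‖ ≤ 1 :=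
  LinearMap.mkContinuous_norm_le _ zero_le_one _

theorem stripCompress_one (hΘ : Θ.transpose = -Θ) (l : Fin k → ℕ) : stripCompress hΘ l 1 = 1 := by
  apply Subtype.ext
  change adjoint (strip Θ l) ∘L strip Θ l = 1
  rw [adjoint_strip_comp_strip, if_pos rfl]

/-- The link with the series of the theorem, whose terms compress `L_l^* X L_l` by `Q`. -/
theorem stripCompress_zero_conj (hΘ : Θ.transpose = -Θ) (l : Fin k → ℕ) (X : toeplitz Θ) :
    stripCompress hΘ 0 (star (gen Θ (inl d l)) * X * gen Θ (inl d l)) = stripCompress hΘ l X := by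
  apply Subtype.ext
  rw [coe_stripCompress, coe_stripCompress, strip_zero, strip, adjoint_comp]
  rfl

/-! ### The commutant of the core -/

/-- The commutant of `{S, S^*}` is a closed star-subalgebra, so the generators suffice. -/
theorem commute_of_mem_coreAlg {S : Ell2 (k + d) →L[ℂ] Ell2 (k + d)}
    (h1 : ∀ x, S * leftRegular Θ (inr k x) = leftRegular Θ (inr k x) * S)
    (h2 : ∀ x, star S * leftRegular Θ (inr k x) = leftRegular Θ (inr k x) * star S)
    {X : toeplitz Θ} (hX : X ∈ coreAlg Θ) : S * (X : Ell2 (k + d) →L[ℂ] Ell2 (k + d)) = X * S := by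
  have hle : coreAlg Θ ≤ (StarSubalgebra.centralizer ℂ {S}).comap (toeplitz Θ).subtype := by
    refine StarSubalgebra.topologicalClosure_minimal (StarAlgebra.adjoin_le ?_) ?_
    · rintro _ ⟨x, rfl⟩
      change leftRegular Θ (inr k x) ∈ StarSubalgebra.centralizer ℂ {S}
      refine (StarSubalgebra.mem_centralizer_iff ℂ).2 ?_
      rintro _ rfl
      exact ⟨h1 x, h2 x⟩
    · exact (Set.isClosed_centralizer ({S} ∪ star {S})).preimage continuous_subtype_val
  exact ((StarSubalgebra.mem_centralizer_iff ℂ).1 (hle hX) S rfl).1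

theorem rightRegular_mul_of_mem_coreAlg (l : Fin k → ℕ) {X : toeplitz Θ} (hX : X ∈ coreAlg Θ) :
    rightRegular Θ (inl d l) * (X : Ell2 (k + d) →L[ℂ] Ell2 (k + d))
      = X * rightRegular Θ (inl d l) :=
  commute_of_mem_coreAlg (fun _ => rightRegular_mul_leftRegular _ _)
    (fun x => star_rightRegular_mul_leftRegular (disjSupp_inl_inr l x)) hX

theorem adjoint_coreIncl_comp_leftRegular (x : Fin d → ℕ) :
    adjoint (coreIncl k d) ∘L leftRegular Θ (inr k x)
      = leftRegular (lowerRight Θ) x ∘L adjoint (coreIncl k d) := by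
  have := congrArg adjoint (star_leftRegular_inr_comp_coreIncl (k := k) (Θ := Θ) x)
  rwa [adjoint_comp, adjoint_comp, ← star_eq_adjoint (star _), star_star,
    ← star_eq_adjoint (star _), star_star] at this

theorem coreProj_mul_of_mem_coreAlg {X : toeplitz Θ} (hX : X ∈ coreAlg Θ) :
    (coreIncl k d ∘L adjoint (coreIncl k d)) * (X : Ell2 (k + d) →L[ℂ] Ell2 (k + d))
      = X * (coreIncl k d ∘L adjoint (coreIncl k d)) := by
  have h (x : Fin d → ℕ) : (coreIncl k d ∘L adjoint (coreIncl k d)) * leftRegular Θ (inr k x)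
      = leftRegular Θ (inr k x) * (coreIncl k d ∘L adjoint (coreIncl k d)) := by
    rw [mul_def, mul_def, comp_assoc, adjoint_coreIncl_comp_leftRegular, ← comp_assoc,
      ← comp_assoc, leftRegular_inr_comp_coreIncl]
  refine commute_of_mem_coreAlg h (fun x => ?_) hX
  rw [star_eq_adjoint, adjoint_comp, adjoint_adjoint]
  exact h x

theorem adjoint_coreIncl_comp_coreIncl : adjoint (coreIncl k d) ∘L coreIncl k d = 1 := by
  have := adjoint_strip_comp_strip (Θ := (0 : Matrix (Fin (k + d)) (Fin (k + d)) ℝ)) 0 0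
  rwa [strip_zero, if_pos rfl] at this

/-- The projection onto strip `0` commutes with the core, so `X` maps this strip into itself. -/
theorem comp_coreIncl_of_mem_coreAlg (hΘ : Θ.transpose = -Θ) {X : toeplitz Θ}
    (hX : X ∈ coreAlg Θ) :
    (X : Ell2 (k + d) →L[ℂ] Ell2 (k + d)) ∘L coreIncl k d
      = coreIncl k d ∘L (stripCompress hΘ 0 X : Ell2 d →L[ℂ] Ell2 d) := by
  have h := congrArg (· ∘L coreIncl k d) (coreProj_mul_of_mem_coreAlg hX)
  simp only [mul_def, comp_assoc, adjoint_coreIncl_comp_coreIncl] at h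
  rw [coe_stripCompress, strip_zero, h]
  rfl

/-! ### The projection `Q` -/

theorem projQ_basisVec (m : Fin (k + d) → ℕ) :
    (projQ Θ : Ell2 (k + d) →L[ℂ] Ell2 (k + d)) (basisVec m)
      = if ∀ j, m (Fin.castAdd d j) = 0 then basisVec m else 0 := by
  -- Partial products over arbitrary finite sets allow an induction; the factor with index `j` kills
  -- `δ_m` exactly when `m_j ≥ 1`.
  suffices h : ∀ (s : Finset (Fin k)) (hc), ((s.noncommProd
      (fun j : Fin k => 1 - gen Θ (stdIdx d j) * star (gen Θ (stdIdx d j))) hc : toeplitz Θ) :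
        Ell2 (k + d) →L[ℂ] Ell2 (k + d)) (basisVec m)
      = if ∀ j ∈ s, m (Fin.castAdd d j) = 0 then basisVec m else 0 by
    refine (h Finset.univ _).trans ?_
    simp
  intro s
  induction s using Finset.cons_induction with
  | empty => intro _; simp
  | cons a s ha ih =>
    intro hc
    rw [Finset.noncommProd_cons, MulMemClass.coe_mul, mul_apply_eq_comp, ih]
    have h1 : ((1 - gen Θ (stdIdx d a) * star (gen Θ (stdIdx d a)) : toeplitz Θ) :
        Ell2 (k + d) →L[ℂ] Ell2 (k + d)) (basisVec m)
        = if m (Fin.castAdd d a) = 0 then basisVec m else 0 := by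
      change (1 - leftRegular Θ (stdIdx d a) * star (leftRegular Θ (stdIdx d a))) (basisVec m) = _
      have hle : stdIdx d a ≤ m ↔ m (Fin.castAdd d a) ≠ 0 := by
        refine ⟨fun h => ?_, fun h i => ?_⟩
        · have := h (Fin.castAdd d a)
          rw [stdIdx, Pi.single_eq_same] at this
          exact Nat.one_le_iff_ne_zero.1 this
        · by_cases hi : i = Fin.castAdd d a
          · subst hi
            rw [stdIdx, Pi.single_eq_same]
            exact Nat.one_le_iff_ne_zero.2 h
          · rw [stdIdx, Pi.single_eq_of_ne hi]
            exact Nat.zero_le _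
      rw [sub_apply, range_proj_basisVec, one_apply_eq_self, hle]
      by_cases h : m (Fin.castAdd d a) = 0 <;> simp [h]
    by_cases h : ∀ j ∈ s, m (Fin.castAdd d j) = 0
    · rw [if_pos h, h1]
      by_cases h' : m (Fin.castAdd d a) = 0
      · rw [if_pos h', if_pos (by simpa [h'] using h)]
      · rw [if_neg h', if_neg fun H => h' (H a (Finset.mem_cons_self _ _))]
    · rw [if_neg h, map_zero, if_neg fun H => h fun j hj => H j (Finset.mem_cons_of_mem hj)]

theorem adjoint_coreIncl_basisVec (l : Fin k → ℕ) (q : Fin d → ℕ) :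
    adjoint (coreIncl k d) (basisVec (inl d l + inr k q)) = if l = 0 then basisVec q else 0 := by
  apply eq_of_inner_basisVec
  intro q'
  have : basisVec (inr k q') = basisVec (inl d (0 : Fin k → ℕ) + inr k q') := by
    rw [inl_zero, zero_add]
  rw [adjoint_inner_right, coreIncl_basisVec, this, inner_basisVec]
  simp only [inl_add_inr_inj]
  by_cases h : l = 0
  · simp [h, inner_basisVec]
  · simp [h, Ne.symm h]

theorem coe_projQ :
    (projQ Θ : Ell2 (k + d) →L[ℂ] Ell2 (k + d)) = coreIncl k d ∘L adjoint (coreIncl k d) := by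
  apply clm_ext
  intro m
  obtain ⟨l, q, rfl⟩ := exists_eq_inl_add_inr m
  rw [projQ_basisVec, comp_apply, adjoint_coreIncl_basisVec]
  have : (∀ j, (inl d l + inr k q) (Fin.castAdd d j) = 0) ↔ l = 0 := by
    simp [inl_castAdd, inr_castAdd, funext_iff]
  rw [if_congr this rfl rfl]
  by_cases h : l = 0
  · rw [if_pos h, if_pos h, coreIncl_basisVec, h, inl_zero, zero_add]
  · simp [h]

theorem projQ_mul_of_mem_coreAlg {X : toeplitz Θ} (hX : X ∈ coreAlg Θ) :
    projQ Θ * X = X * projQ Θ := by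
  apply Subtype.ext
  change (projQ Θ : Ell2 (k + d) →L[ℂ] Ell2 (k + d)) * X = X * projQ Θ
  rw [coe_projQ, coreProj_mul_of_mem_coreAlg hX]

theorem coe_projQ_mul_mul_projQ (hΘ : Θ.transpose = -Θ) (X : toeplitz Θ) :
    ((projQ Θ * X * projQ Θ : toeplitz Θ) : Ell2 (k + d) →L[ℂ] Ell2 (k + d))
      = coreIncl k d ∘L (stripCompress hΘ 0 X : Ell2 d →L[ℂ] Ell2 d) ∘L
        adjoint (coreIncl k d) := by
  rw [MulMemClass.coe_mul, MulMemClass.coe_mul, coe_projQ, coe_stripCompress, strip_zero]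
  simp only [mul_def, comp_assoc]

/-- `Q X Q = W_0 S_0(X) W_0^*` and `W_0^* W_0 = 1`, so each of `Q X Q` and `S_0(X)` is recovered
from the other. -/
theorem projQ_mul_mul_projQ_eq_iff (hΘ : Θ.transpose = -Θ) {X Y : toeplitz Θ} :
    projQ Θ * X * projQ Θ = projQ Θ * Y * projQ Θ
      ↔ stripCompress hΘ 0 X = stripCompress hΘ 0 Y := by
  constructor
  · intro h
    apply Subtype.ext
    have h' := congrArg (fun Z : toeplitz Θ => adjoint (coreIncl k d) ∘L
      (Z : Ell2 (k + d) →L[ℂ] Ell2 (k + d)) ∘L coreIncl k d) h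
    simp only [coe_projQ_mul_mul_projQ hΘ, comp_assoc, adjoint_coreIncl_comp_coreIncl] at h'
    simp only [← comp_assoc, adjoint_coreIncl_comp_coreIncl] at h'
    exact h'
  · intro h
    apply Subtype.ext
    rw [coe_projQ_mul_mul_projQ hΘ, coe_projQ_mul_mul_projQ hΘ, h]

theorem stripCompress_projQ_mul_mul_projQ (hΘ : Θ.transpose = -Θ) (X : toeplitz Θ) :
    stripCompress hΘ 0 (projQ Θ * X * projQ Θ) = stripCompress hΘ 0 X := by
  rw [← projQ_mul_mul_projQ_eq_iff]
  have h := (isStarProjection_projQ Θ).isIdempotentElem.eq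
  calc projQ Θ * (projQ Θ * X * projQ Θ) * projQ Θ
      = (projQ Θ * projQ Θ) * X * (projQ Θ * projQ Θ) := by simp only [mul_assoc]
    _ = projQ Θ * X * projQ Θ := by rw [h]

/-! ### The identifications of the core -/

/-- Only the right factor has to preserve strip `0`: `Y W_0 = W_0 S_0(Y)`. -/
theorem stripCompress_mul_of_mem_coreAlg (hΘ : Θ.transpose = -Θ) (X : toeplitz Θ) {Y : toeplitz Θ}
    (hY : Y ∈ coreAlg Θ) :
    stripCompress hΘ 0 (X * Y) = stripCompress hΘ 0 X * stripCompress hΘ 0 Y := by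
  apply Subtype.ext
  change adjoint (strip Θ 0) ∘L ((X : Ell2 (k + d) →L[ℂ] Ell2 (k + d)) ∘L
    (Y : Ell2 (k + d) →L[ℂ] Ell2 (k + d))) ∘L strip Θ 0 = (adjoint (strip Θ 0) ∘L
    (X : Ell2 (k + d) →L[ℂ] Ell2 (k + d)) ∘L strip Θ 0) ∘L
    (stripCompress hΘ 0 Y : Ell2 d →L[ℂ] Ell2 d)
  rw [strip_zero, comp_assoc, comp_assoc, comp_assoc, comp_coreIncl_of_mem_coreAlg hΘ hY]

theorem stripCompress_star (hΘ : Θ.transpose = -Θ) (l : Fin k → ℕ) (X : toeplitz Θ) :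
    stripCompress hΘ l (star X) = star (stripCompress hΘ l X) := by
  apply Subtype.ext
  change adjoint (strip Θ l) ∘L adjoint (X : Ell2 (k + d) →L[ℂ] Ell2 (k + d)) ∘L strip Θ l
    = adjoint (adjoint (strip Θ l) ∘L (X : Ell2 (k + d) →L[ℂ] Ell2 (k + d)) ∘L strip Θ l)
  rw [adjoint_comp, adjoint_comp, adjoint_adjoint, comp_assoc]

/-- The compression to the strip with index `0`, as a homomorphism on the core. -/
def coreHom (hΘ : Θ.transpose = -Θ) : coreAlg Θ →⋆ₐ[ℂ] toeplitz (lowerRight Θ) where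
  toFun X := stripCompress hΘ 0 (X : toeplitz Θ)
  map_one' := stripCompress_one hΘ 0
  map_mul' X Y := stripCompress_mul_of_mem_coreAlg hΘ X Y.2
  map_zero' := map_zero (stripCompress hΘ 0)
  map_add' X Y := map_add (stripCompress hΘ 0) (X : toeplitz Θ) Y
  commutes' c := by
    change stripCompress hΘ 0 (algebraMap ℂ (toeplitz Θ) c) = _
    rw [Algebra.algebraMap_eq_smul_one, map_smul, stripCompress_one,
      Algebra.algebraMap_eq_smul_one]
  map_star' X := stripCompress_star hΘ 0 X

theorem coreHom_apply (hΘ : Θ.transpose = -Θ) (X : coreAlg Θ) :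
    coreHom hΘ X = stripCompress hΘ 0 (X : toeplitz Θ) :=
  rfl

theorem coreHom_gen (hΘ : Θ.transpose = -Θ) (x : Fin d → ℕ) (h : gen Θ (inr k x) ∈ coreAlg Θ) :
    coreHom hΘ ⟨gen Θ (inr k x), h⟩ = gen (lowerRight Θ) x := by
  apply Subtype.ext
  rw [coreHom_apply, coe_stripCompress, strip_zero]
  change adjoint (coreIncl k d) ∘L leftRegular Θ (inr k x) ∘L coreIncl k d = _
  rw [leftRegular_inr_comp_coreIncl, ← comp_assoc, adjoint_coreIncl_comp_coreIncl]
  rfl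

theorem gen_inr_mem_coreAlg (Θ : Matrix (Fin (k + d)) (Fin (k + d)) ℝ) (x : Fin d → ℕ) :
    gen Θ (inr k x) ∈ coreAlg Θ :=
  StarSubalgebra.le_topologicalClosure _ (StarAlgebra.subset_adjoin ℂ _ ⟨x, rfl⟩)

/-- If `S_0(X) = 0`, then `X` vanishes on strip `0`. The isometry `R_l` commutes with `X` and
carries strip `0` onto strip `l`, so `X` vanishes on every strip. -/
theorem coreHom_injective (hΘ : Θ.transpose = -Θ) :
    Function.Injective (coreHom (k := k) (d := d) hΘ) := by
  rw [injective_iff_map_eq_zero]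
  intro X hX
  apply Subtype.ext
  apply Subtype.ext
  have h0 : ((X : toeplitz Θ) : Ell2 (k + d) →L[ℂ] Ell2 (k + d)) ∘L coreIncl k d = 0 := by
    rw [comp_coreIncl_of_mem_coreAlg hΘ X.2, ← coreHom_apply, hX]
    exact comp_zero _
  apply clm_ext
  intro m
  obtain ⟨l, q, rfl⟩ := exists_eq_inl_add_inr m
  have h1 : basisVec (inl d l + inr k q) = (starRingEnd ℂ) (cocycle Θ (inr k q) (inl d l) : ℂ) •
      rightRegular Θ (inl d l) (coreIncl k d (basisVec q)) := by
    rw [coreIncl_basisVec, rightRegular_basisVec, smul_smul, conj_mul_circle, one_smul]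
  have h2 := DFunLike.congr_fun (rightRegular_mul_of_mem_coreAlg l X.2)
    (coreIncl k d (basisVec q))
  have h3 := DFunLike.congr_fun h0 (basisVec q)
  rw [mul_apply_eq_comp, mul_apply_eq_comp] at h2
  rw [comp_apply] at h3
  rw [h1, map_smul, ← h2, h3]
  simp

/-- An injective star-homomorphism of C*-algebras is isometric, so its range is closed; the range
contains the generators. -/
theorem coreHom_surjective (hΘ : Θ.transpose = -Θ) :
    Function.Surjective (coreHom (k := k) (d := d) hΘ) := by
  have := isClosed_toeplitz Θ
  have := isClosed_toeplitz (lowerRight Θ)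
  have := isClosed_coreAlg Θ
  have : CompleteSpace (coreAlg Θ) := inferInstance
  have hiso : Isometry (coreHom (k := k) (d := d) hΘ) :=
    NonUnitalStarAlgHom.isometry _ (coreHom_injective hΘ)
  have hcl : IsClosed (Set.range ((toeplitz (lowerRight Θ)).subtype.comp (coreHom hΘ))) :=
    (isometry_subtype_coe.comp hiso).isClosedEmbedding.isClosed_range
  have hle : toeplitz (lowerRight Θ) ≤
      ((toeplitz (lowerRight Θ)).subtype.comp (coreHom hΘ)).range := by
    refine StarSubalgebra.topologicalClosure_minimal (StarAlgebra.adjoin_le ?_) hcl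
    rintro _ ⟨x, rfl⟩
    exact ⟨⟨gen Θ (inr k x), gen_inr_mem_coreAlg Θ x⟩, congrArg Subtype.val (coreHom_gen hΘ x _)⟩
  intro Y
  obtain ⟨X, hX⟩ := hle Y.2
  exact ⟨X, Subtype.ext hX⟩

/-- The canonical isomorphism of `T_r(ℕᵈ, σ_{Θ_d})` with the core. -/
def coreEquiv (hΘ : Θ.transpose = -Θ) : toeplitz (lowerRight Θ) ≃⋆ₐ[ℂ] coreAlg Θ :=
  (StarAlgEquiv.ofBijective (coreHom hΘ) ⟨coreHom_injective hΘ, coreHom_surjective hΘ⟩).symm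

theorem coreEquiv_gen (hΘ : Θ.transpose = -Θ) (x : Fin d → ℕ) :
    (coreEquiv hΘ (gen (lowerRight Θ) x) : toeplitz Θ) = gen Θ (inr k x) := by
  have : gen (lowerRight Θ) x = (coreEquiv hΘ).symm ⟨gen Θ (inr k x), gen_inr_mem_coreAlg Θ x⟩ :=
    (coreHom_gen hΘ x _).symm
  rw [this, StarAlgEquiv.apply_symm_apply]

/-- The compression `ρ_Q` as a homomorphism of the core to the corner. -/
def cornerHom (Θ : Matrix (Fin (k + d)) (Fin (k + d)) ℝ) : coreAlg Θ →⋆ₙₐ[ℂ] cornerQ Θ where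
  toFun X := compressQ Θ (X : toeplitz Θ)
  map_smul' c X := Subtype.ext (by
    change projQ Θ * (c • (X : toeplitz Θ)) * projQ Θ = c • (projQ Θ * (X : toeplitz Θ) * projQ Θ)
    rw [mul_smul_comm, smul_mul_assoc])
  map_zero' := Subtype.ext (by
    change projQ Θ * 0 * projQ Θ = 0
    rw [mul_zero, zero_mul])
  map_add' X Y := Subtype.ext (by
    change projQ Θ * ((X : toeplitz Θ) + Y) * projQ Θ
      = projQ Θ * (X : toeplitz Θ) * projQ Θ + projQ Θ * (Y : toeplitz Θ) * projQ Θ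
    rw [mul_add, add_mul])
  map_mul' X Y := Subtype.ext (by
    have h := (isStarProjection_projQ Θ).isIdempotentElem.eq
    have hX := projQ_mul_of_mem_coreAlg X.2
    change projQ Θ * ((X : toeplitz Θ) * Y) * projQ Θ
      = projQ Θ * (X : toeplitz Θ) * projQ Θ * (projQ Θ * (Y : toeplitz Θ) * projQ Θ)
    -- Multiplicative because `Q` commutes with the core.
    calc projQ Θ * ((X : toeplitz Θ) * Y) * projQ Θ
        = projQ Θ * X * Y * projQ Θ := by simp only [mul_assoc]
      _ = X * (projQ Θ * projQ Θ * projQ Θ) * Y * projQ Θ := by rw [h, h, hX]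
      _ = (X * projQ Θ) * projQ Θ * (projQ Θ * Y * projQ Θ) := by simp only [mul_assoc]
      _ = _ := by rw [← hX])
  map_star' X := Subtype.ext (by
    change projQ Θ * star (X : toeplitz Θ) * projQ Θ = star (projQ Θ * (X : toeplitz Θ) * projQ Θ)
    rw [star_mul, star_mul, (isStarProjection_projQ Θ).isSelfAdjoint.star_eq, mul_assoc])

end

section
variable {k d : ℕ} {Θ : Matrix (Fin (k + d)) (Fin (k + d)) ℝ}

theorem stripCompress_coreEquiv (hΘ : Θ.transpose = -Θ) (Y : toeplitz (lowerRight Θ)) :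
    stripCompress hΘ 0 (coreEquiv hΘ Y : toeplitz Θ) = Y :=
  (coreEquiv hΘ).left_inv Y

theorem coreEquiv_stripCompress (hΘ : Θ.transpose = -Θ) (X : coreAlg Θ) :
    coreEquiv hΘ (stripCompress hΘ 0 (X : toeplitz Θ)) = X :=
  (coreEquiv hΘ).right_inv X

/-- The isomorphism `ρ_Q` of the core onto the corner. -/
def cornerEquiv (hΘ : Θ.transpose = -Θ) : coreAlg Θ ≃⋆ₐ[ℂ] cornerQ Θ where
  toFun X := compressQ Θ (X : toeplitz Θ)
  invFun Z := coreEquiv hΘ (stripCompress hΘ 0 (Z : toeplitz Θ))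
  left_inv X := (congrArg (coreEquiv hΘ)
    (stripCompress_projQ_mul_mul_projQ hΘ (X : toeplitz Θ))).trans (coreEquiv_stripCompress hΘ X)
  -- `Z` and the core element `ι(S_0(Z))` have the same compression to strip `0`, hence the same
  -- compression by `Q`, and `Q Z Q = Z`.
  right_inv Z := Subtype.ext (((projQ_mul_mul_projQ_eq_iff hΘ).2
    (stripCompress_coreEquiv hΘ (stripCompress hΘ 0 (Z : toeplitz Θ)))).trans Z.2)
  map_mul' := (cornerHom Θ).map_mul'
  map_add' := (cornerHom Θ).map_add'
  map_star' := (cornerHom Θ).map_star'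
  map_smul' := (cornerHom Θ).map_smul'

theorem cornerEquiv_apply (hΘ : Θ.transpose = -Θ) (X : coreAlg Θ) :
    cornerEquiv hΘ X = compressQ Θ (X : toeplitz Θ) :=
  rfl

theorem coreEquiv_symm_cornerEquiv_symm (hΘ : Θ.transpose = -Θ) (X : toeplitz Θ) :
    (coreEquiv hΘ).symm ((cornerEquiv hΘ).symm (compressQ Θ X)) = stripCompress hΘ 0 X :=
  ((coreEquiv hΘ).left_inv _).trans (stripCompress_projQ_mul_mul_projQ hΘ X)

end

/-! ### States -/

section States

variable {A : Type*} [NormedRing A] [StarRing A] [NormedAlgebra ℂ A] [StarModule ℂ A]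
  {φ : WeakDual ℂ A}

/-- Polarization: `φ((1 + z a)^* (1 + z a))` is real, and the choices `z = 1` and `z = i` give the
imaginary and the real part. -/
theorem states_map_star (hφ : φ ∈ states A) (a : A) : φ (star a) = (starRingEnd ℂ) (φ a) := by
  have key (z : ℂ) : (z * φ a + (starRingEnd ℂ) z * φ (star a)).im = 0 := by
    have h0 := (Complex.nonneg_iff.1 (hφ.2 a)).2
    have h1 := (Complex.nonneg_iff.1 (hφ.2 (1 + z • a))).2
    have h2 : star (1 + z • a) * (1 + z • a) = 1 + z • a + (starRingEnd ℂ) z • star a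
        + (Complex.normSq z : ℂ) • (star a * a) := by
      rw [star_add, star_one, star_smul, add_mul, one_mul, mul_add, mul_one, smul_mul_smul_comm,
        Complex.normSq_eq_conj_mul_self, Complex.star_def]
      abel
    rw [h2, map_add, map_add, map_add, map_smul, map_smul, map_smul, hφ.1] at h1
    simp only [smul_eq_mul, Complex.add_im, Complex.one_im, Complex.im_ofReal_mul, ← h0,
      mul_zero, zero_add, add_zero] at h1
    rw [Complex.add_im]
    exact h1.symm
  have h1 := key 1
  have h2 := key Complex.I
  simp at h1 h2
  apply Complex.ext
  · rw [Complex.conj_re]; linarith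
  · rw [Complex.conj_im]; linarith

/-- The pre-inner product `⟨a, b⟩ = φ (a^* b)` of a state. -/
@[reducible]
def stateCore (hφ : φ ∈ states A) : PreInnerProductSpace.Core ℂ A where
  inner a b := φ (star a * b)
  conj_inner_symm a b := by
    rw [← states_map_star hφ, star_mul, star_star]
  re_inner_nonneg a := (Complex.nonneg_iff.1 (hφ.2 a)).1
  add_left a b c := by rw [star_add, add_mul, map_add]
  smul_left a b z := by
    rw [star_smul, smul_mul_assoc, map_smul]
    rfl

theorem states_cauchy_schwarz (hφ : φ ∈ states A) (a b : A) :
    ‖φ (star a * b)‖ ^ 2 ≤ (φ (star a * a)).re * (φ (star b * b)).re := by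
  let := stateCore hφ
  have h : ‖φ (star a * b)‖ * ‖φ (star b * a)‖ ≤ (φ (star a * a)).re * (φ (star b * b)).re :=
    InnerProductSpace.Core.inner_mul_inner_self_le (𝕜 := ℂ) a b
  have h2 : φ (star b * a) = (starRingEnd ℂ) (φ (star a * b)) := by
    rw [← states_map_star hφ, star_mul, star_star]
  rwa [h2, Complex.norm_conj, ← pow_two] at h

end States

/-! ### Square roots inside closed subalgebras and the norm bound for states -/

section Positivity

/-- The square root lies in the C*-algebra generated by `x`, hence in `S`. Positivity of a state
refers to `a^* a` with `a` in the subalgebra, whereas a compression is only seen to be positive as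
an operator. -/
theorem StarSubalgebra.exists_eq_star_mul_self {A : Type*} [CStarAlgebra A] [PartialOrder A]
    [StarOrderedRing A] {S : StarSubalgebra ℂ A} (hS : IsClosed (S : Set A)) {x : A} (hx : x ∈ S)
    (h0 : 0 ≤ x) : ∃ c ∈ S, x = star c * c := by
  refine ⟨CFC.sqrt x, ?_, ?_⟩
  · rw [CFC.sqrt_eq_real_sqrt _ h0, cfcₙ_eq_cfc, cfc_real_eq_complex]
    exact StarAlgebra.elemental.le_of_mem hS hx (cfc_mem_elemental _ _)
  · rw [(CFC.sqrt_nonneg x).isSelfAdjoint.star_eq, CFC.sqrt_mul_sqrt_self _ h0]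

variable {n : ℕ} {Θ : Matrix (Fin n) (Fin n) ℝ}

theorem exists_eq_star_mul_self (X : toeplitz Θ)
    (hX : (X : Ell2 n →L[ℂ] Ell2 n).IsPositive) : ∃ c : toeplitz Θ, X = star c * c := by
  obtain ⟨c, hc, h⟩ := StarSubalgebra.exists_eq_star_mul_self (isClosed_toeplitz Θ) X.2
    ((ContinuousLinearMap.nonneg_iff_isPositive _).2 hX)
  exact ⟨⟨c, hc⟩, Subtype.ext h⟩

theorem states_nonneg_of_isPositive {φ : WeakDual ℂ (toeplitz Θ)} (hφ : φ ∈ states (toeplitz Θ))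
    (X : toeplitz Θ) (hX : (X : Ell2 n →L[ℂ] Ell2 n).IsPositive) : 0 ≤ φ X := by
  obtain ⟨c, rfl⟩ := exists_eq_star_mul_self X hX
  exact hφ.2 c

/-- Follows from `|φ(X)|² ≤ φ(X^* X) ≤ ‖X‖²`. The bound is uniform over states, as the weak*
continuity of `gibbs` requires. -/
theorem states_norm_le {φ : WeakDual ℂ (toeplitz Θ)} (hφ : φ ∈ states (toeplitz Θ))
    (X : toeplitz Θ) : ‖φ X‖ ≤ ‖X‖ := by
  have h1 := states_cauchy_schwarz hφ 1 X
  rw [star_one, one_mul, one_mul, hφ.1, Complex.one_re, one_mul] at h1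
  have h2 : 0 ≤ φ (((‖X‖ ^ 2 : ℝ) : ℂ) • 1 - star X * X) := by
    refine states_nonneg_of_isPositive hφ _ ?_
    have := CStarAlgebra.star_mul_le_algebraMap_norm_sq (a := (X : Ell2 n →L[ℂ] Ell2 n))
    rw [ContinuousLinearMap.le_def] at this
    have h : ((((‖X‖ ^ 2 : ℝ) : ℂ) • 1 - star X * X : toeplitz Θ) : Ell2 n →L[ℂ] Ell2 n)
        = algebraMap ℝ _ (‖(X : Ell2 n →L[ℂ] Ell2 n)‖ ^ 2) - star (X : Ell2 n →L[ℂ] Ell2 n) * X := by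
      rw [Algebra.algebraMap_eq_smul_one]
      rfl
    rwa [h]
  rw [map_sub, map_smul, hφ.1, smul_eq_mul, mul_one] at h2
  have h3 := (Complex.nonneg_iff.1 h2).1
  rw [Complex.sub_re, Complex.ofReal_re, sub_nonneg] at h3
  exact (pow_le_pow_iff_left₀ (norm_nonneg _) (norm_nonneg _) two_ne_zero).1 (h1.trans h3)

end Positivity

/-! ### The Gibbs weights -/

section Weights

theorem hasSum_pi_geometric {k : ℕ} (z : Fin k → ℂ) (hz : ∀ j, ‖z j‖ < 1) :
    HasSum (fun l : Fin k → ℕ => ∏ j, z j ^ l j) (∏ j, (1 - z j)⁻¹) := by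
  induction k with
  | zero => simp
  | succ k ih =>
    have h1 := hasSum_geometric_of_norm_lt_one (hz 0)
    have h2 := ih (fun j => z j.succ) fun j => hz _
    have h1' : Summable fun i : ℕ => ‖z 0 ^ i‖ := h1.summable.norm
    have h2' : Summable fun l : Fin k → ℕ => ‖∏ j, z j.succ ^ l j‖ := h2.summable.norm
    have h3 := summable_mul_of_summable_norm (R := ℂ) (f := fun i : ℕ => z 0 ^ i)
      (g := fun l : Fin k → ℕ => ∏ j, z j.succ ^ l j) h1' h2'
    have h3 := h1.mul h2 h3
    rw [Fin.prod_univ_succ]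
    refine (Equiv.hasSum_iff (Fin.consEquiv fun _ : Fin (k + 1) => ℕ)).1 ?_
    have h4 : (fun l : Fin (k + 1) → ℕ => ∏ j, z j ^ l j) ∘ (Fin.consEquiv fun _ => ℕ)
        = fun x : ℕ × (Fin k → ℕ) => z 0 ^ x.1 * ∏ j, z j.succ ^ x.2 j := by
      funext x
      rw [Function.comp_apply, Fin.prod_univ_succ]
      rfl
    rw [h4]
    exact h3

variable {k : ℕ} {r : Fin k → ℝ} {β : ℝ}

theorem norm_exp_neg_lt_one (hr : ∀ j, 0 < r j) (hβ : 0 < β) (j : Fin k) :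
    ‖Complex.exp (-β * r j)‖ < 1 := by
  rw [Complex.norm_exp, Real.exp_lt_one_iff]
  have := mul_pos hβ (hr j)
  simpa using this

theorem ofReal_exp_pairing (l : Fin k → ℕ) :
    ((Real.exp (-β * pairing l r) : ℝ) : ℂ) = ∏ j, Complex.exp (-β * r j) ^ l j := by
  simp only [← Complex.exp_nat_mul]
  rw [← Complex.exp_sum, Complex.ofReal_exp, pairing]
  push_cast
  rw [Finset.mul_sum]
  congr 1
  exact Finset.sum_congr rfl fun j _ => by ring

theorem hasSum_weight (hr : ∀ j, 0 < r j) (hβ : 0 < β) :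
    HasSum (fun l : Fin k → ℕ => ((Real.exp (-β * pairing l r) : ℝ) : ℂ))
      (∏ j, (1 - Complex.exp (-β * r j))⁻¹) := by
  simp only [ofReal_exp_pairing]
  exact hasSum_pi_geometric _ (norm_exp_neg_lt_one hr hβ)

theorem summable_weight (hr : ∀ j, 0 < r j) (hβ : 0 < β) :
    Summable fun l : Fin k → ℕ => Real.exp (-β * pairing l r) :=
  Complex.summable_ofReal.1 (hasSum_weight hr hβ).summable

theorem partitionFn_pos (hr : ∀ j, 0 < r j) (hβ : 0 < β) : 0 < partitionFn r β :=
  (summable_weight hr hβ).tsum_pos (fun _ => (Real.exp_pos _).le) 0 (Real.exp_pos _)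

theorem ofReal_partitionFn (hr : ∀ j, 0 < r j) (hβ : 0 < β) :
    (partitionFn r β : ℂ) = ∏ j, (1 - Complex.exp (-β * r j))⁻¹ := by
  rw [partitionFn, Complex.ofReal_tsum]
  exact (hasSum_weight hr hβ).tsum_eq

/-- The normalized weight `Z(β)⁻¹ exp (-β ⟨l, r⟩)`. -/
def gibbsWeight (r : Fin k → ℝ) (β : ℝ) (l : Fin k → ℕ) : ℝ :=
  (partitionFn r β)⁻¹ * Real.exp (-β * pairing l r)

theorem gibbsWeight_nonneg (hr : ∀ j, 0 < r j) (hβ : 0 < β) (l : Fin k → ℕ) :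
    0 ≤ gibbsWeight r β l :=
  mul_nonneg (inv_nonneg.2 (partitionFn_pos hr hβ).le) (Real.exp_pos _).le

theorem summable_gibbsWeight (hr : ∀ j, 0 < r j) (hβ : 0 < β) : Summable (gibbsWeight r β) :=
  (summable_weight hr hβ).mul_left _

theorem tsum_gibbsWeight (hr : ∀ j, 0 < r j) (hβ : 0 < β) : ∑' l, gibbsWeight r β l = 1 := by
  simp only [gibbsWeight]
  rw [tsum_mul_left]
  exact inv_mul_cancel₀ (partitionFn_pos hr hβ).ne'

theorem gibbsWeight_zero : gibbsWeight r β 0 = (partitionFn r β)⁻¹ := by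
  simp [gibbsWeight, pairing]

theorem gibbsWeight_add (p l : Fin k → ℕ) :
    gibbsWeight r β (p + l) = Real.exp (-β * pairing p r) * gibbsWeight r β l := by
  rw [gibbsWeight, gibbsWeight, pairing_add_left, mul_add, Real.exp_add]
  ring

end Weights

/-! ### Extension from monomials -/

section Ext

variable {n : ℕ} {Θ : Matrix (Fin n) (Fin n) ℝ}

theorem toeplitz_clm_ext (hΘ : Θ.transpose = -Θ) {f g : toeplitz Θ →L[ℂ] ℂ}
    (h : ∀ p q, f (gen Θ p * star (gen Θ q)) = g (gen Θ p * star (gen Θ q))) : f = g := by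
  -- The induction principle speaks of operators, so the equalizer is pushed into the ambient
  -- algebra; it stays closed there because the subalgebra is closed.
  have key : ∀ Y ∈ toeplitz Θ, Y ∈ Subtype.val '' {X : toeplitz Θ | f X = g X} := by
    intro Y hY
    refine toeplitz_induction hΘ (P := fun Y => Y ∈ Subtype.val '' {X : toeplitz Θ | f X = g X})
      ?_ ?_ ?_ ?_ hY
    · exact (isClosed_toeplitz Θ).isClosedEmbedding_subtypeVal.isClosedMap _
        (isClosed_eq f.continuous g.continuous)
    · rintro _ _ ⟨X, hX, rfl⟩ ⟨X', hX', rfl⟩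
      refine ⟨X + X', ?_, rfl⟩
      change f (X + X') = g (X + X')
      rw [map_add, map_add, show f X = g X from hX, show f X' = g X' from hX']
    · rintro c _ ⟨X, hX, rfl⟩
      refine ⟨c • X, ?_, rfl⟩
      change f (c • X) = g (c • X)
      rw [map_smul, map_smul, show f X = g X from hX]
    · intro p q
      exact ⟨gen Θ p * star (gen Θ q), h p q, rfl⟩
  ext X
  obtain ⟨X', hX', h'⟩ := key X X.2
  rw [Subtype.ext h'] at hX'
  exact hX'

end Ext

/-! ### Compression to a strip and multiplication by generators -/

section Strip

variable {k d : ℕ} {Θ : Matrix (Fin (k + d)) (Fin (k + d)) ℝ}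

open ContinuousLinearMap

theorem coe_gen {n : ℕ} (Θ : Matrix (Fin n) (Fin n) ℝ) (p : Fin n → ℕ) :
    (gen Θ p : Ell2 n →L[ℂ] Ell2 n) = leftRegular Θ p :=
  rfl

theorem coe_stripCompress_mul (hΘ : Θ.transpose = -Θ) (l : Fin k → ℕ) (A B : toeplitz Θ) :
    (stripCompress hΘ l (A * B) : Ell2 d →L[ℂ] Ell2 d)
      = adjoint (star (A : Ell2 (k + d) →L[ℂ] Ell2 (k + d)) ∘L strip Θ l) ∘L
        ((B : Ell2 (k + d) →L[ℂ] Ell2 (k + d)) ∘L strip Θ l) := by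
  rw [coe_stripCompress, MulMemClass.coe_mul, adjoint_comp, star_eq_adjoint, adjoint_adjoint,
    mul_def, comp_assoc, comp_assoc]

/-- Both sides equal `σ(p, m) W_m^* a W_{p+m}`. This shift of the strip index is the source of the
KMS factor. -/
theorem stripCompress_gen_inl_mul (hΘ : Θ.transpose = -Θ) (p m : Fin k → ℕ) (a : toeplitz Θ) :
    stripCompress hΘ (p + m) (gen Θ (inl d p) * a)
      = stripCompress hΘ m (a * gen Θ (inl d p)) := by
  apply Subtype.ext
  rw [coe_stripCompress_mul, coe_stripCompress, MulMemClass.coe_mul, coe_gen, mul_def, comp_assoc,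
    star_leftRegular_comp_strip_add, leftRegular_comp_strip, map_smulₛₗ, Complex.conj_conj,
    comp_smul, comp_smul, smul_comp]

theorem stripCompress_gen_inl_mul_of_not_le (hΘ : Θ.transpose = -Θ) {p l : Fin k → ℕ}
    (h : ¬ p ≤ l) (a : toeplitz Θ) : stripCompress hΘ l (gen Θ (inl d p) * a) = 0 := by
  apply Subtype.ext
  rw [coe_stripCompress_mul, coe_gen, star_leftRegular_comp_strip_of_not_le h, map_zero, zero_comp,
    ZeroMemClass.coe_zero]

theorem stripCompress_gen_inr_mul (hΘ : Θ.transpose = -Θ) (l : Fin k → ℕ) (x : Fin d → ℕ)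
    (a : toeplitz Θ) : stripCompress hΘ l (gen Θ (inr k x) * a)
      = ((cocycle Θ (inr k x) (inl d l) ^ 2 : Circle) : ℂ) •
        (gen (lowerRight Θ) x * stripCompress hΘ l a) := by
  apply Subtype.ext
  rw [coe_stripCompress_mul, coe_gen, SetLike.val_smul, MulMemClass.coe_mul, coe_gen,
    coe_stripCompress, star_leftRegular_inr_comp_strip hΘ, map_smulₛₗ, Complex.conj_conj, smul_comp,
    adjoint_comp, star_eq_adjoint, adjoint_adjoint, mul_def, comp_assoc]

theorem stripCompress_mul_gen_inr (hΘ : Θ.transpose = -Θ) (l : Fin k → ℕ) (x : Fin d → ℕ)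
    (a : toeplitz Θ) : stripCompress hΘ l (a * gen Θ (inr k x))
      = ((cocycle Θ (inr k x) (inl d l) ^ 2 : Circle) : ℂ) •
        (stripCompress hΘ l a * gen (lowerRight Θ) x) := by
  apply Subtype.ext
  rw [coe_stripCompress, SetLike.val_smul, MulMemClass.coe_mul, MulMemClass.coe_mul, coe_gen,
    coe_gen, coe_stripCompress, mul_def, comp_assoc, leftRegular_inr_comp_strip hΘ, comp_smul,
    comp_smul, mul_def, comp_assoc, comp_assoc]

open scoped Classical in
theorem stripCompress_monomial (hΘ : Θ.transpose = -Θ) (l p q : Fin k → ℕ) (x y : Fin d → ℕ) :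
    stripCompress hΘ l (gen Θ (inl d p) * gen Θ (inr k x) * star (gen Θ (inr k y)) *
        star (gen Θ (inl d q)))
      = (if p = q ∧ p ≤ l then stripPhase Θ x y (l - p) else 0) •
        (gen (lowerRight Θ) x * star (gen (lowerRight Θ) y)) := by
  apply Subtype.ext
  simp only [coe_stripCompress, SetLike.val_smul, MulMemClass.coe_mul, StarMemClass.coe_star, coe_gen]
  rw [← compress_monomial hΘ l p q x y]
  simp only [mul_assoc]

theorem stripCompress_star_mul_self_isPositive (hΘ : Θ.transpose = -Θ) (l : Fin k → ℕ)
    (a : toeplitz Θ) :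
    (stripCompress hΘ l (star a * a) : Ell2 d →L[ℂ] Ell2 d).IsPositive := by
  rw [coe_stripCompress_mul, StarMemClass.coe_star, star_star]
  exact isPositive_adjoint_comp_self _

end Strip

/-! ### The functionals `T_β(τ)` -/

section Series

variable {ι E F : Type*} [NormedAddCommGroup E] [NormedSpace ℂ E] [NormedAddCommGroup F]
  [NormedSpace ℂ F]

theorem hasSum_smul_comp (τ : StrongDual ℂ F) (S : ι → E →L[ℂ] F) (hS : ∀ l, ‖S l‖ ≤ 1)
    {c : ι → ℝ} (hc : ∀ l, 0 ≤ c l) (hs : Summable c) (X : E) :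
    HasSum (fun l => (c l : ℂ) * τ (S l X)) ((∑' l, (c l : ℂ) • τ.comp (S l)) X) := by
  -- Absolute convergence in the norm of the dual, so the sum is a bounded functional.
  have hs : Summable fun l => (c l : ℂ) • τ.comp (S l) := by
    refine Summable.of_norm_bounded (hs.mul_right ‖τ‖) fun l => ?_
    rw [norm_smul, Complex.norm_real, Real.norm_of_nonneg (hc l)]
    exact mul_le_mul_of_nonneg_left ((ContinuousLinearMap.opNorm_comp_le _ _).trans
      (mul_le_of_le_one_right (norm_nonneg _) (hS l))) (hc l)
  exact hs.hasSum.mapL (ContinuousLinearMap.apply ℂ ℂ X)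

end Series

section Gibbs

variable {k d : ℕ} {Θ : Matrix (Fin (k + d)) (Fin (k + d)) ℝ} {r : Fin k → ℝ} {β : ℝ}

/-- The functional `X ↦ Z(β)⁻¹ ∑_l exp (-β ⟨l, r⟩) τ (W_l^* X W_l)`. -/
def gibbs (hΘ : Θ.transpose = -Θ) (r : Fin k → ℝ) (β : ℝ)
    (τ : WeakDual ℂ (toeplitz (lowerRight Θ))) : WeakDual ℂ (toeplitz Θ) :=
  StrongDual.toWeakDual
    (∑' l, (gibbsWeight r β l : ℂ) • (WeakDual.toStrongDual τ).comp (stripCompress hΘ l))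

theorem hasSum_gibbs (hΘ : Θ.transpose = -Θ) (hr : ∀ j, 0 < r j) (hβ : 0 < β)
    (τ : WeakDual ℂ (toeplitz (lowerRight Θ))) (X : toeplitz Θ) :
    HasSum (fun l => (gibbsWeight r β l : ℂ) * τ (stripCompress hΘ l X)) (gibbs hΘ r β τ X) :=
  hasSum_smul_comp (WeakDual.toStrongDual τ) (stripCompress hΘ) (norm_stripCompress_le hΘ)
    (gibbsWeight_nonneg hr hβ) (summable_gibbsWeight hr hβ) X

theorem gibbs_mem_states (hΘ : Θ.transpose = -Θ) (hr : ∀ j, 0 < r j) (hβ : 0 < β)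
    {τ : WeakDual ℂ (toeplitz (lowerRight Θ))} (hτ : τ ∈ states (toeplitz (lowerRight Θ))) :
    gibbs hΘ r β τ ∈ states (toeplitz Θ) := by
  refine ⟨?_, fun a => ?_⟩
  · refine (hasSum_gibbs hΘ hr hβ τ 1).unique ?_
    simp only [stripCompress_one, hτ.1, mul_one]
    have h := Complex.hasSum_ofReal.2 (summable_gibbsWeight hr hβ).hasSum
    rwa [tsum_gibbsWeight hr hβ, Complex.ofReal_one] at h
  · refine (hasSum_gibbs hΘ hr hβ τ (star a * a)).nonneg fun l => ?_
    refine mul_nonneg (Complex.zero_le_real.2 (gibbsWeight_nonneg hr hβ l)) ?_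
    exact states_nonneg_of_isPositive hτ _ (stripCompress_star_mul_self_isPositive hΘ l a)

/-- The terms with `l` not above `p` vanish, so the sum runs over `l = p + m`. -/
theorem hasSum_gibbs_gen_inl_mul (hΘ : Θ.transpose = -Θ) (hr : ∀ j, 0 < r j) (hβ : 0 < β)
    (τ : WeakDual ℂ (toeplitz (lowerRight Θ))) (p : Fin k → ℕ) (a : toeplitz Θ) :
    HasSum (fun m => (gibbsWeight r β (p + m) : ℂ) *
      τ (stripCompress hΘ (p + m) (gen Θ (inl d p) * a))) (gibbs hΘ r β τ (gen Θ (inl d p) * a)) := by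
  refine ((add_right_injective p).hasSum_iff ?_).2 (hasSum_gibbs hΘ hr hβ τ (gen Θ (inl d p) * a))
  intro l hl
  have hpl : ¬ p ≤ l := fun h => hl ⟨l - p, add_tsub_cancel_of_le h⟩
  rw [stripCompress_gen_inl_mul_of_not_le hΘ hpl, map_zero, mul_zero]

theorem gibbs_gen_inl_mul (hΘ : Θ.transpose = -Θ) (hr : ∀ j, 0 < r j) (hβ : 0 < β)
    (τ : WeakDual ℂ (toeplitz (lowerRight Θ))) (p : Fin k → ℕ) (a : toeplitz Θ) :
    gibbs hΘ r β τ (gen Θ (inl d p) * a)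
      = (Real.exp (-β * pairing p r) : ℂ) * gibbs hΘ r β τ (a * gen Θ (inl d p)) := by
  have h := hasSum_gibbs_gen_inl_mul hΘ hr hβ τ p a
  simp only [gibbsWeight_add, stripCompress_gen_inl_mul, Complex.ofReal_mul, mul_assoc] at h
  exact h.unique ((hasSum_gibbs hΘ hr hβ τ (a * gen Θ (inl d p))).mul_left _)

/-- On each strip, multiplication by `L_x` from the left and from the right produces the same phase,
so traciality of `τ` matches the series term by term. -/
theorem gibbs_gen_inr_mul (hΘ : Θ.transpose = -Θ) (hr : ∀ j, 0 < r j) (hβ : 0 < β)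
    {τ : WeakDual ℂ (toeplitz (lowerRight Θ))} (hτ : τ ∈ tracialStates (toeplitz (lowerRight Θ)))
    (x : Fin d → ℕ) (a : toeplitz Θ) :
    gibbs hΘ r β τ (gen Θ (inr k x) * a) = gibbs hΘ r β τ (a * gen Θ (inr k x)) := by
  have h := hasSum_gibbs hΘ hr hβ τ (gen Θ (inr k x) * a)
  have h' := hasSum_gibbs hΘ hr hβ τ (a * gen Θ (inr k x))
  simp only [stripCompress_gen_inr_mul, map_smul, hτ.2 (gen _ x)] at h
  simp only [stripCompress_mul_gen_inr, map_smul] at h'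
  exact h.unique h'

theorem gen_add {n : ℕ} (Θ : Matrix (Fin n) (Fin n) ℝ) (p q : Fin n → ℕ) :
    gen Θ (p + q) = (starRingEnd ℂ) (cocycle Θ p q : ℂ) • (gen Θ p * gen Θ q) :=
  Subtype.ext (leftRegular_add p q)

theorem pairing_inl_add_inr (p : Fin k → ℕ) (x : Fin d → ℕ) :
    pairing (inl d p + inr k x) (extendZero d r) = pairing p r := by
  rw [pairing, Fin.sum_univ_add]
  simp [inl_castAdd, inr_castAdd, extendZero, pairing]

theorem gibbs_gen_mul (hΘ : Θ.transpose = -Θ) (hr : ∀ j, 0 < r j) (hβ : 0 < β)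
    {τ : WeakDual ℂ (toeplitz (lowerRight Θ))} (hτ : τ ∈ tracialStates (toeplitz (lowerRight Θ)))
    (p : Fin (k + d) → ℕ) (a : toeplitz Θ) :
    gibbs hΘ r β τ (gen Θ p * a)
      = (Real.exp (-β * pairing p (extendZero d r)) : ℂ) * gibbs hΘ r β τ (a * gen Θ p) := by
  obtain ⟨p, x, rfl⟩ := exists_eq_inl_add_inr p
  rw [pairing_inl_add_inr, gen_add, smul_mul_assoc, mul_smul_comm, map_smul, map_smul, mul_assoc,
    gibbs_gen_inl_mul hΘ hr hβ, mul_assoc (gen Θ (inr k x)), gibbs_gen_inr_mul hΘ hr hβ hτ,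
    mul_assoc a, smul_eq_mul, smul_eq_mul]
  ring

/-- The phase is `exp (-2πi ⟨x - y, Θ m⟩)`, which antisymmetry turns into `exp (2πi ⟨m, Θ(x - y)⟩)`;
this factors over the coordinates of `m`. -/
theorem gibbsWeight_mul_stripPhase (hΘ : Θ.transpose = -Θ) (x y : Fin d → ℕ) (m : Fin k → ℕ) :
    (Real.exp (-β * pairing m r) : ℂ) * stripPhase Θ x y m
      = ∏ j, Complex.exp (-β * r j + 2 * Real.pi * Complex.I *
        ((Θ.mulVec (fun i => (inr k x i : ℝ) - (inr k y i : ℝ)) (Fin.castAdd d j) : ℝ) : ℂ))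
          ^ m j := by
  have h1 (v : Fin (k + d) → ℝ) : pairing (inl d m) v = ∑ j, (m j : ℝ) * v (Fin.castAdd d j) := by
    rw [pairing, Fin.sum_univ_add]
    simp [inl_castAdd, inl_natAdd]
  have h2 (u : Fin d → ℕ) : pairing (inr k u) (Θ.mulVec fun j => (inl d m j : ℝ))
      = -∑ j, (m j : ℝ) * Θ.mulVec (fun i => (inr k u i : ℝ)) (Fin.castAdd d j) := by
    rw [pairing_mulVec_swap hΘ, h1]
  have h3 : (fun i => (inr k x i : ℝ) - (inr k y i : ℝ))
      = (fun i => (inr k x i : ℝ)) - fun i => (inr k y i : ℝ) := rfl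
  have h4 (a b : Fin k → ℝ) : ∑ j, (m j : ℂ) *
      (-β * r j + 2 * Real.pi * Complex.I * ((a j - b j : ℝ) : ℂ))
      = -β * (∑ j, (m j : ℝ) * r j : ℝ) + 2 * Real.pi * Complex.I *
        ((∑ j, (m j : ℝ) * a j : ℝ) - (∑ j, (m j : ℝ) * b j : ℝ)) := by
    push_cast
    rw [← Finset.sum_sub_distrib, Finset.mul_sum, Finset.mul_sum, ← Finset.sum_add_distrib]
    exact Finset.sum_congr rfl fun j _ => by ring
  simp only [← Complex.exp_nat_mul]
  rw [← Complex.exp_sum, stripPhase, ← Circle.coe_inv_eq_conj, ← Circle.coe_mul, cocycle, cocycle,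
    ← inv_pow, ← Circle.exp_neg, ← Circle.exp_nsmul, ← Circle.exp_nsmul, ← Circle.exp_add,
    Circle.coe_exp, Complex.ofReal_exp, ← Complex.exp_add, h2, h2, h3, Matrix.mulVec_sub]
  simp only [Pi.sub_apply]
  rw [h4, pairing]
  congr 1
  push_cast
  simp only [nsmul_eq_mul]
  push_cast
  ring

/-- For `p = q` the series is a product of geometric series whose ratios have modulus `exp (-β r_j)
< 1`. The factor `Z(β)⁻¹` supplies the numerators `1 - exp (-β r_j)`, and the shift by `p` supplies
`exp (-β r_j p_j)`. -/
theorem gibbs_monomial (hΘ : Θ.transpose = -Θ) (hr : ∀ j, 0 < r j) (hβ : 0 < β)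
    (τ : WeakDual ℂ (toeplitz (lowerRight Θ))) (p q : Fin k → ℕ) (x y : Fin d → ℕ) :
    gibbs hΘ r β τ (gen Θ (inl d p) * gen Θ (inr k x) * star (gen Θ (inr k y)) *
        star (gen Θ (inl d q))) =
      if p = q then
        τ (gen (lowerRight Θ) x * star (gen (lowerRight Θ) y)) * eulerProduct Θ r β p x y
      else 0 := by
  classical
  have h := hasSum_gibbs_gen_inl_mul hΘ hr hβ τ p (gen Θ (inr k x) * star (gen Θ (inr k y)) *
        star (gen Θ (inl d q)))
  simp only [← mul_assoc, stripCompress_monomial, map_smul] at h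
  by_cases hpq : p = q
  · subst hpq
    rw [if_pos rfl]
    set z : Fin k → ℂ := fun j => Complex.exp (-β * r j + 2 * Real.pi * Complex.I *
      ((Θ.mulVec (fun i => (inr k x i : ℝ) - (inr k y i : ℝ)) (Fin.castAdd d j) : ℝ) : ℂ))
      with hz
    have hz1 (j : Fin k) : ‖z j‖ < 1 := by
      rw [hz, Complex.norm_exp, Real.exp_lt_one_iff]
      simpa using mul_pos hβ (hr j)
    set t := τ (gen (lowerRight Θ) x * star (gen (lowerRight Θ) y))
    have h1 := (hasSum_pi_geometric z hz1).mul_left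
      ((Real.exp (-β * pairing p r) : ℂ) * (partitionFn r β : ℂ)⁻¹ * t)
    have h2 : (fun m : Fin k → ℕ => (Real.exp (-β * pairing p r) : ℂ) * (partitionFn r β : ℂ)⁻¹ * t
        * ∏ j, z j ^ m j) = fun m => (gibbsWeight r β (p + m) : ℂ) * ((if p = p ∧ p ≤ p + m then
          stripPhase Θ x y (p + m - p) else 0) * t) := by
      funext m
      rw [if_pos ⟨rfl, le_add_of_nonneg_right zero_le⟩, add_tsub_cancel_left, hz,
        ← gibbsWeight_mul_stripPhase hΘ, gibbsWeight_add, gibbsWeight]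
      push_cast
      ring
    rw [h2] at h1
    refine (h.unique h1).trans ?_
    rw [ofReal_partitionFn hr hβ, ofReal_exp_pairing, eulerProduct, mul_comm _ t, mul_assoc,
      ← Finset.prod_inv_distrib, ← Finset.prod_mul_distrib, ← Finset.prod_mul_distrib]
    congr 1
    refine Finset.prod_congr rfl fun j _ => ?_
    rw [inv_inv, div_eq_mul_inv, ← Complex.exp_nat_mul]
    congr 3
    ring
  · rw [if_neg hpq]
    refine h.unique ?_
    simp only [hpq, false_and, if_false, zero_smul, mul_zero]
    exact hasSum_zero

end Gibbs

/-! ### Eigenelements of the dynamics -/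

section Dynamics

variable {n : ℕ} {Θ : Matrix (Fin n) (Fin n) ℝ} {r : Fin n → ℝ}

theorem coe_dynamics (t : ℝ) (a : toeplitz Θ) :
    (dynamics Θ r t a : Ell2 n →L[ℂ] Ell2 n) = diagOp r t * a * star (diagOp r t) :=
  rfl

theorem star_diagOp_mul_diagOp (t : ℝ) : star (diagOp r t) * diagOp r t = 1 :=
  star_mul_self_of_isometry _

theorem dynamics_mul (t : ℝ) (a b : toeplitz Θ) :
    dynamics Θ r t (a * b) = dynamics Θ r t a * dynamics Θ r t b := by
  apply Subtype.ext
  rw [MulMemClass.coe_mul, coe_dynamics, coe_dynamics, coe_dynamics, MulMemClass.coe_mul]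
  calc diagOp r t * ((a : Ell2 n →L[ℂ] Ell2 n) * b) * star (diagOp r t)
      = diagOp r t * a * 1 * b * star (diagOp r t) := by simp only [mul_assoc, one_mul]
    _ = _ := by rw [← star_diagOp_mul_diagOp (r := r) t]; simp only [mul_assoc]

theorem dynamics_star (t : ℝ) (a : toeplitz Θ) :
    dynamics Θ r t (star a) = star (dynamics Θ r t a) := by
  apply Subtype.ext
  rw [StarMemClass.coe_star, coe_dynamics, coe_dynamics, StarMemClass.coe_star, star_mul, star_mul,
    star_star, mul_assoc]

/-- `α_t(a) = exp (i s t) a` for all `t`. -/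
def IsEigen (Θ : Matrix (Fin n) (Fin n) ℝ) (r : Fin n → ℝ) (s : ℝ) (a : toeplitz Θ) : Prop :=
  ∀ t : ℝ, dynamics Θ r t a = Complex.exp (s * t * Complex.I) • a

theorem isEigen_gen (p : Fin n → ℕ) : IsEigen Θ r (pairing p r) (gen Θ p) := by
  intro t
  rw [dynamics_gen, Circle.coe_exp]
  push_cast
  rfl

theorem IsEigen.mul {s s' : ℝ} {a b : toeplitz Θ} (ha : IsEigen Θ r s a)
    (hb : IsEigen Θ r s' b) : IsEigen Θ r (s + s') (a * b) := by
  intro t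
  rw [dynamics_mul, ha t, hb t, smul_mul_smul_comm, ← Complex.exp_add]
  push_cast
  ring_nf

theorem IsEigen.star {s : ℝ} {a : toeplitz Θ} (ha : IsEigen Θ r s a) :
    IsEigen Θ r (-s) (star a) := by
  intro t
  rw [dynamics_star, ha t, star_smul, Complex.star_def, ← Complex.exp_conj]
  simp

theorem isEigen_zero_of_commute {a : toeplitz Θ}
    (h : ∀ t, diagOp r t * (a : Ell2 n →L[ℂ] Ell2 n) = a * diagOp r t) : IsEigen Θ r 0 a := by
  intro t
  apply Subtype.ext
  rw [coe_dynamics, h, mul_assoc, star_diagOp, diagOp_mul_neg, mul_one]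
  simp

theorem isEntireExtension_of_isEigen {s : ℝ} {a : toeplitz Θ} (ha : IsEigen Θ r s a) :
    IsEntireExtension (dynamics Θ r) a fun z => Complex.exp (s * z * Complex.I) • a :=
  ⟨by fun_prop, fun t => (ha t).symm⟩

/-- The entire extension `z ↦ exp (i s z) a` takes the value `exp (-β s) a` at `z = iβ`. -/
theorem kms_of_isEigen {β : ℝ} {φ : WeakDual ℂ (toeplitz Θ)} (hφ : φ ∈ kmsStates (dynamics Θ r) β)
    {s : ℝ} {a : toeplitz Θ} (ha : IsEigen Θ r s a) (b : toeplitz Θ) :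
    φ (a * b) = (Real.exp (-β * s) : ℂ) * φ (b * a) := by
  rw [hφ.2 a _ (isEntireExtension_of_isEigen ha) b, mul_smul_comm, map_smul, smul_eq_mul,
    Complex.ofReal_exp]
  congr 2
  push_cast
  linear_combination (s * β : ℂ) * Complex.I_sq

/-- Complex conjugation turns the relation for `L_q` into the one for `L_q^*`, with the inverse
factor. -/
theorem map_monomial_mul {β : ℝ} {φ : WeakDual ℂ (toeplitz Θ)} (hφ : φ ∈ states (toeplitz Θ))
    (h : ∀ p a, φ (gen Θ p * a) = (Real.exp (-β * pairing p r) : ℂ) * φ (a * gen Θ p))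
    (p q : Fin n → ℕ) (a : toeplitz Θ) :
    φ (gen Θ p * star (gen Θ q) * a) = (Real.exp (-β * (pairing p r - pairing q r)) : ℂ) *
      φ (a * (gen Θ p * star (gen Θ q))) := by
  have hstar (b : toeplitz Θ) :
      φ (star (gen Θ q) * b) = (Real.exp (β * pairing q r) : ℂ) * φ (b * star (gen Θ q)) := by
    have h1 := congrArg (starRingEnd ℂ) (h q (star b))
    rw [map_mul (starRingEnd ℂ), Complex.conj_ofReal, ← states_map_star hφ, ← states_map_star hφ, star_mul,
      star_mul, star_star] at h1
    rw [h1, ← mul_assoc, ← Complex.ofReal_mul, ← Real.exp_add]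
    simp
  rw [mul_assoc, h, mul_assoc, hstar, ← mul_assoc, ← Complex.ofReal_mul, ← Real.exp_add,
    mul_assoc a]
  congr 3
  ring

/-- The automorphism `α_t` as a continuous linear map. -/
def dynamicsCLM (Θ : Matrix (Fin n) (Fin n) ℝ) (r : Fin n → ℝ) (t : ℝ) :
    toeplitz Θ →L[ℂ] toeplitz Θ :=
  LinearMap.mkContinuous
    { toFun := dynamics Θ r t
      map_add' := fun a b => Subtype.ext (by
        rw [AddMemClass.coe_add, coe_dynamics, coe_dynamics, coe_dynamics, AddMemClass.coe_add,
          mul_add, add_mul])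
      map_smul' := fun c a => Subtype.ext (by
        rw [SetLike.val_smul, coe_dynamics, coe_dynamics, SetLike.val_smul, mul_smul_comm,
          smul_mul_assoc, RingHom.id_apply]) } 1 (fun a => by
      have h : ‖diagOp r t‖ ≤ 1 := LinearIsometry.norm_toContinuousLinearMap_le _
      change ‖diagOp r t * (a : Ell2 n →L[ℂ] Ell2 n) * star (diagOp r t)‖
        ≤ 1 * ‖(a : Ell2 n →L[ℂ] Ell2 n)‖
      refine (norm_mul_le _ _).trans ((mul_le_of_le_one_right (norm_nonneg _) ?_).trans ?_)
      · rw [star_diagOp]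
        exact LinearIsometry.norm_toContinuousLinearMap_le _
      · exact (norm_mul_le _ _).trans (mul_le_mul_of_nonneg_right h (norm_nonneg _)))

theorem eq_of_differentiable_of_real {f g : ℂ → ℂ} (hf : Differentiable ℂ f)
    (hg : Differentiable ℂ g) (h : ∀ t : ℝ, f t = g t) : f = g := by
  refine AnalyticOnNhd.eq_of_frequently_eq (z₀ := 0) (fun z _ => hf.analyticAt z)
    (fun z _ => hg.analyticAt z) ?_
  have ht : Filter.Tendsto (fun t : ℝ => (t : ℂ)) (nhdsWithin 0 {0}ᶜ) (nhdsWithin 0 {0}ᶜ) := by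
    refine tendsto_nhdsWithin_iff.2 ⟨?_, ?_⟩
    · exact (Complex.continuous_ofReal.tendsto' 0 0 Complex.ofReal_zero).mono_left
        nhdsWithin_le_nhds
    · filter_upwards [self_mem_nhdsWithin] with t ht
      exact Complex.ofReal_ne_zero.2 ht
  exact ht.frequently (Filter.Eventually.frequently (Filter.Eventually.of_forall h))

/-- For a monomial `V` of frequency `s`, invariance of `φ` takes the form `φ(V α_t(a)) = exp (-i s
t) φ(V a)`. For analytic `a` both sides are entire in `t`, so `t = iβ` may be inserted: `φ(V F(iβ))
= exp (β s) φ(V a) = φ(a V)`. By density of the span, `V` may be replaced by any `b`. -/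
theorem mem_kmsStates_of_gen (hΘ : Θ.transpose = -Θ) {β : ℝ} (hβ : β ≠ 0)
    {φ : WeakDual ℂ (toeplitz Θ)} (hφ : φ ∈ states (toeplitz Θ))
    (h : ∀ p a, φ (gen Θ p * a) = (Real.exp (-β * pairing p r) : ℂ) * φ (a * gen Θ p)) :
    φ ∈ kmsStates (dynamics Θ r) β := by
  have key := map_monomial_mul hφ h
  have hinv (p q p' q' : Fin n → ℕ) (t : ℝ) :
      φ (gen Θ p * star (gen Θ q) * dynamics Θ r t (gen Θ p' * star (gen Θ q')))
        = Complex.exp (-((pairing p r - pairing q r : ℝ) * t * Complex.I)) *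
          φ (gen Θ p * star (gen Θ q) * (gen Θ p' * star (gen Θ q'))) := by
    rw [((isEigen_gen p').mul (isEigen_gen q').star) t, mul_smul_comm, map_smul, smul_eq_mul]
    set s := pairing p r - pairing q r
    set s' := pairing p' r + -pairing q' r with hs'
    by_cases hs : s + s' = 0
    · have : s' = -s := by linarith
      rw [this]
      push_cast
      ring_nf
    -- Exchanging the two monomials twice multiplies the value by `exp (-β (s + s'))`, which differs
    -- from `1` as `β ≠ 0`; hence the value is zero.
    · have h1 := key p q (gen Θ p' * star (gen Θ q'))
      have h2 := key p' q' (gen Θ p * star (gen Θ q))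
      rw [h2, ← mul_assoc (Real.exp _ : ℂ), ← Complex.ofReal_mul, ← Real.exp_add] at h1
      have h3 : φ (gen Θ p * star (gen Θ q) * (gen Θ p' * star (gen Θ q'))) = 0 := by
        by_contra hne
        have h4 := (mul_eq_right₀ hne).1 h1.symm
        rw [Complex.ofReal_eq_one, Real.exp_eq_one_iff] at h4
        apply hs
        have h5 : -β * (s + s') = 0 := by
          rw [← h4, hs']
          ring
        exact (mul_eq_zero.1 h5).resolve_left (neg_ne_zero.2 hβ)
      rw [h3, mul_zero, mul_zero]
  have hdyn (p q : Fin n → ℕ) (t : ℝ) (a : toeplitz Θ) :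
      φ (gen Θ p * star (gen Θ q) * dynamics Θ r t a)
        = Complex.exp (-((pairing p r - pairing q r : ℝ) * t * Complex.I)) *
          φ (gen Θ p * star (gen Θ q) * a) := by
    set M := ContinuousLinearMap.mul ℂ (toeplitz Θ) (gen Θ p * star (gen Θ q))
    have h1 : (WeakDual.toStrongDual φ).comp (M.comp (dynamicsCLM Θ r t))
        = Complex.exp (-((pairing p r - pairing q r : ℝ) * t * Complex.I)) •
          (WeakDual.toStrongDual φ).comp M :=
      toeplitz_clm_ext hΘ fun p' q' => hinv p q p' q' t
    exact DFunLike.congr_fun h1 a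
  refine ⟨hφ, fun a F hF b => ?_⟩
  have hmono (p q : Fin n → ℕ) : φ (a * (gen Θ p * star (gen Θ q)))
      = φ (gen Θ p * star (gen Θ q) * F (Complex.I * β)) := by
    have hd : Differentiable ℂ fun z => φ (gen Θ p * star (gen Θ q) * F z) :=
      ((WeakDual.toStrongDual φ).comp
        (ContinuousLinearMap.mul ℂ (toeplitz Θ) (gen Θ p * star (gen Θ q)))).differentiable.comp hF.1
    have h1 := eq_of_differentiable_of_real hd (g := fun z : ℂ =>
      Complex.exp (-((pairing p r - pairing q r : ℝ) * z * Complex.I)) *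
        φ (gen Θ p * star (gen Θ q) * a)) (by fun_prop)
      (fun t => by rw [hF.2 t, hdyn])
    have h2 := congrFun h1 (Complex.I * β)
    rw [h2, key, ← mul_assoc (Complex.exp _), Complex.ofReal_exp, ← Complex.exp_add]
    have h3 : -(((pairing p r - pairing q r : ℝ) : ℂ) * (Complex.I * β) * Complex.I)
        + ((-β * (pairing p r - pairing q r) : ℝ) : ℂ) = 0 := by
      push_cast
      linear_combination (-(pairing p r - pairing q r) * β : ℂ) * Complex.I_sq
    rw [h3, Complex.exp_zero, one_mul]
  have h1 : (WeakDual.toStrongDual φ).comp (ContinuousLinearMap.mul ℂ (toeplitz Θ) a)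
      = (WeakDual.toStrongDual φ).comp
        ((ContinuousLinearMap.mul ℂ (toeplitz Θ)).flip (F (Complex.I * β))) :=
    toeplitz_clm_ext hΘ hmono
  exact DFunLike.congr_fun h1 b

end Dynamics

section Converse

variable {k d : ℕ} {Θ : Matrix (Fin (k + d)) (Fin (k + d)) ℝ} {r : Fin k → ℝ} {β : ℝ}

open ContinuousLinearMap

/-! ### Fixed points of the dynamics -/

theorem pairing_inl (p : Fin k → ℕ) : pairing (inl d p) (extendZero d r) = pairing p r := by
  have := pairing_inl_add_inr (r := r) p (0 : Fin d → ℕ)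
  rwa [inr_zero, add_zero] at this

theorem pairing_inr (x : Fin d → ℕ) : pairing (inr k x) (extendZero d r) = 0 := by
  have := pairing_inl_add_inr (r := r) (0 : Fin k → ℕ) x
  rw [inl_zero, zero_add] at this
  rw [this]
  simp [pairing]

theorem diagOp_mul_leftRegular_inr (t : ℝ) (x : Fin d → ℕ) :
    diagOp (extendZero d r) t * leftRegular Θ (inr k x)
      = leftRegular Θ (inr k x) * diagOp (extendZero d r) t := by
  apply clm_ext
  intro m
  rw [mul_apply_eq_comp, mul_apply_eq_comp, leftRegular_basisVec, map_smul, diagOp_basisVec,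
    diagOp_basisVec, map_smul, leftRegular_basisVec, pairing_add_left, pairing_inr, zero_add,
    smul_smul, smul_smul, mul_comm]

theorem isEigen_of_mem_coreAlg {X : toeplitz Θ} (hX : X ∈ coreAlg Θ) :
    IsEigen Θ (extendZero d r) 0 X :=
  isEigen_zero_of_commute fun t => commute_of_mem_coreAlg
    (fun x => diagOp_mul_leftRegular_inr t x)
    (fun x => by rw [star_diagOp]; exact diagOp_mul_leftRegular_inr (-t) x) hX

theorem isEigen_projQ : IsEigen Θ (extendZero d r) 0 (projQ Θ) := by
  refine isEigen_zero_of_commute fun t => clm_ext fun m => ?_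
  rw [mul_apply_eq_comp, mul_apply_eq_comp, diagOp_basisVec, map_smul, projQ_basisVec]
  split_ifs
  · rw [diagOp_basisVec]
  · rw [map_zero, smul_zero]

/-! ### The projections onto the strips -/

theorem projQ_mul_projQ : projQ Θ * projQ Θ = projQ Θ :=
  (isStarProjection_projQ Θ).isIdempotentElem.eq

theorem star_projQ : star (projQ Θ) = projQ Θ :=
  (isStarProjection_projQ Θ).isSelfAdjoint.star_eq

/-- The projection `L_l Q L_l^*` onto the strip with index `l`. -/
def stripProj (Θ : Matrix (Fin (k + d)) (Fin (k + d)) ℝ) (l : Fin k → ℕ) : toeplitz Θ :=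
  gen Θ (inl d l) * projQ Θ * star (gen Θ (inl d l))

theorem coe_stripProj (l : Fin k → ℕ) :
    (stripProj Θ l : Ell2 (k + d) →L[ℂ] Ell2 (k + d)) = strip Θ l ∘L adjoint (strip Θ l) := by
  rw [stripProj, MulMemClass.coe_mul, MulMemClass.coe_mul, StarMemClass.coe_star, coe_gen,
    coe_projQ, strip, adjoint_comp, star_eq_adjoint, mul_def, mul_def, comp_assoc, comp_assoc,
    comp_assoc]

theorem star_stripProj (l : Fin k → ℕ) : star (stripProj Θ l) = stripProj Θ l := by
  rw [stripProj, star_mul, star_mul, star_star, star_projQ, mul_assoc]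

theorem stripProj_mul_stripProj (l m : Fin k → ℕ) :
    stripProj Θ l * stripProj Θ m = if l = m then stripProj Θ l else 0 := by
  apply Subtype.ext
  rw [MulMemClass.coe_mul, coe_stripProj, coe_stripProj, mul_def, comp_assoc,
    ← comp_assoc (adjoint (strip Θ l)), adjoint_strip_comp_strip]
  split_ifs with h
  · subst h
    rw [coe_stripProj]
    rfl
  · rw [zero_comp, comp_zero, ZeroMemClass.coe_zero]

/-- The complement of finitely many orthogonal projections is a projection; this shape is what
Cauchy–Schwarz consumes. -/
theorem star_mul_self_one_sub_sum_stripProj (F : Finset (Fin k → ℕ)) :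
    star (1 - ∑ l ∈ F, stripProj Θ l) * (1 - ∑ l ∈ F, stripProj Θ l)
      = 1 - ∑ l ∈ F, stripProj Θ l := by
  have h : (∑ l ∈ F, stripProj Θ l) * (∑ l ∈ F, stripProj Θ l) = ∑ l ∈ F, stripProj Θ l := by
    rw [Finset.sum_mul_sum]
    refine Finset.sum_congr rfl fun l hl => ?_
    simp only [stripProj_mul_stripProj]
    rw [Finset.sum_ite_eq, if_pos hl]
  have h2 : star (∑ l ∈ F, stripProj Θ l) = ∑ l ∈ F, stripProj Θ l := by
    rw [star_sum]
    exact Finset.sum_congr rfl fun l _ => star_stripProj l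
  rw [star_sub, star_one, h2, sub_mul, one_mul, mul_sub, mul_one, h, sub_self, sub_zero]

/-! ### The value of a KMS state at `Q` -/

theorem star_gen_mul_commute {n : ℕ} {Θ : Matrix (Fin n) (Fin n) ℝ}
    (hΘ : Θ.transpose = -Θ) {p q : Fin n → ℕ} (h : DisjSupp p q) :
    Commute (star (gen Θ p)) (gen Θ q * star (gen Θ q)) := by
  apply Subtype.ext
  simp only [MulMemClass.coe_mul, StarMemClass.coe_star, coe_gen]
  rw [← mul_assoc, star_leftRegular_mul hΘ h, smul_mul_assoc,
    mul_assoc, mul_assoc, ← star_mul, ← star_mul, leftRegular_mul_comm hΘ q p, star_smul,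
    mul_smul_comm, smul_smul, Complex.star_def, circle_mul_conj, one_smul]

theorem disjSupp_stdIdx {i j : Fin k} (h : i ≠ j) : DisjSupp (stdIdx d i) (stdIdx d j) := by
  intro m
  by_cases hm : m = Fin.castAdd d i
  · refine Or.inr (Pi.single_eq_of_ne ?_ _)
    rw [hm]
    exact fun h' => h (Fin.castAdd_injective _ _ h')
  · exact Or.inl (Pi.single_eq_of_ne hm _)

theorem pairing_stdIdx (j : Fin k) : pairing (stdIdx d j) (extendZero d r) = r j := by
  rw [pairing, Finset.sum_eq_single (Fin.castAdd d j)]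
  · simp [stdIdx, extendZero]
  · intro i _ hi
    rw [stdIdx, Pi.single_eq_of_ne hi]
    simp
  · simp

/-- If `R` is the product of the other factors, `L_{e_a}^*` commutes with `R`, so the KMS condition
gives `φ(L_{e_a} L_{e_a}^* R) = exp (-β r_a) φ(R L_{e_a}^* L_{e_a}) = exp (-β r_a) φ(R)`. Each
factor thus contributes `1 - exp (-β r_a)`. -/
theorem kms_projQ (hΘ : Θ.transpose = -Θ) (hr : ∀ j, 0 < r j) (hβ : 0 < β)
    {φ : WeakDual ℂ (toeplitz Θ)} (hφ : φ ∈ kmsStates (dynamics Θ (extendZero d r)) β) :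
    φ (projQ Θ) = (partitionFn r β : ℂ)⁻¹ := by
  suffices h : ∀ (s : Finset (Fin k)) (hc), φ (s.noncommProd
      (fun j : Fin k => 1 - gen Θ (stdIdx d j) * star (gen Θ (stdIdx d j))) hc)
      = ∏ j ∈ s, (1 - Complex.exp (-β * r j)) by
    rw [ofReal_partitionFn hr hβ, ← Finset.prod_inv_distrib]
    simp only [inv_inv]
    exact h Finset.univ _
  intro s
  induction s using Finset.cons_induction with
  | empty => intro _; simpa using hφ.1.1
  | cons a s ha ih =>
    intro hc
    rw [Finset.noncommProd_cons, Finset.prod_cons]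
    have ih' := ih (hc.mono fun _ => Finset.mem_cons_of_mem)
    have hcomm : Commute (star (gen Θ (stdIdx d a))) (s.noncommProd
        (fun j : Fin k => 1 - gen Θ (stdIdx d j) * star (gen Θ (stdIdx d j)))
        (hc.mono fun _ => Finset.mem_cons_of_mem)) := by
      refine Finset.noncommProd_commute _ _ _ _ fun j hj => ?_
      refine (Commute.one_right _).sub_right (star_gen_mul_commute hΘ (disjSupp_stdIdx ?_))
      rintro rfl
      exact ha hj
    rw [sub_mul, one_mul, map_sub, mul_assoc, hcomm.eq, kms_of_isEigen hφ (isEigen_gen _),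
      mul_assoc, star_gen_mul_gen, mul_one, ih', pairing_stdIdx, Complex.ofReal_exp]
    push_cast
    ring

end Converse

section Converse

variable {k d : ℕ} {Θ : Matrix (Fin (k + d)) (Fin (k + d)) ℝ} {r : Fin k → ℝ} {β : ℝ}

open ContinuousLinearMap

/-! ### The trace of a KMS state -/

theorem coreIncl_comp_mem_toeplitz (hΘ : Θ.transpose = -Θ) (Y : toeplitz (lowerRight Θ)) :
    coreIncl k d ∘L (Y : Ell2 d →L[ℂ] Ell2 d) ∘L adjoint (coreIncl k d) ∈ toeplitz Θ := by
  have h := coe_projQ_mul_mul_projQ hΘ (coreEquiv hΘ Y : toeplitz Θ)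
  rw [stripCompress_coreEquiv] at h
  rw [← h]
  exact Subtype.mem _

/-- The map `Y ↦ Q ι(Y) Q` from `T_r(ℕᵈ, σ_{Θ_d})` to `T_r(ℕⁿ, σ_Θ)`. -/
def cornerIncl (hΘ : Θ.transpose = -Θ) : toeplitz (lowerRight Θ) →L[ℂ] toeplitz Θ :=
  LinearMap.mkContinuous
    { toFun := fun Y => ⟨coreIncl k d ∘L (Y : Ell2 d →L[ℂ] Ell2 d) ∘L adjoint (coreIncl k d),
        coreIncl_comp_mem_toeplitz hΘ Y⟩
      map_add' := fun X Y => Subtype.ext (by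
        change coreIncl k d ∘L ((X : Ell2 d →L[ℂ] Ell2 d) + (Y : Ell2 d →L[ℂ] Ell2 d)) ∘L
          adjoint (coreIncl k d) = _
        rw [add_comp, comp_add]
        rfl)
      map_smul' := fun c X => Subtype.ext (by
        change coreIncl k d ∘L (c • (X : Ell2 d →L[ℂ] Ell2 d)) ∘L adjoint (coreIncl k d) = _
        rw [smul_comp, comp_smul]
        rfl) } 1
    (fun Y => by
      change ‖coreIncl k d ∘L (Y : Ell2 d →L[ℂ] Ell2 d) ∘L adjoint (coreIncl k d)‖
        ≤ 1 * ‖(Y : Ell2 d →L[ℂ] Ell2 d)‖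
      refine (opNorm_comp_le _ _).trans (mul_le_mul norm_coreIncl_le ?_ (norm_nonneg _) zero_le_one)
      refine (opNorm_comp_le _ _).trans (mul_le_of_le_one_right (norm_nonneg _) ?_)
      rw [LinearIsometryEquiv.norm_map]
      exact norm_coreIncl_le)

theorem coe_cornerIncl (hΘ : Θ.transpose = -Θ) (Y : toeplitz (lowerRight Θ)) :
    (cornerIncl hΘ Y : Ell2 (k + d) →L[ℂ] Ell2 (k + d))
      = coreIncl k d ∘L (Y : Ell2 d →L[ℂ] Ell2 d) ∘L adjoint (coreIncl k d) :=
  rfl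

theorem cornerIncl_stripCompress (hΘ : Θ.transpose = -Θ) (X : toeplitz Θ) :
    cornerIncl hΘ (stripCompress hΘ 0 X) = projQ Θ * X * projQ Θ := by
  apply Subtype.ext
  rw [coe_cornerIncl, coe_projQ_mul_mul_projQ hΘ]

theorem cornerIncl_eq (hΘ : Θ.transpose = -Θ) (Y : toeplitz (lowerRight Θ)) :
    cornerIncl hΘ Y = projQ Θ * (coreEquiv hΘ Y : toeplitz Θ) * projQ Θ := by
  rw [← cornerIncl_stripCompress hΘ, stripCompress_coreEquiv]

theorem cornerIncl_mul (hΘ : Θ.transpose = -Θ) (X Y : toeplitz (lowerRight Θ)) :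
    cornerIncl hΘ (X * Y) = cornerIncl hΘ X * cornerIncl hΘ Y := by
  apply Subtype.ext
  rw [MulMemClass.coe_mul, coe_cornerIncl, coe_cornerIncl, coe_cornerIncl, MulMemClass.coe_mul,
    mul_def, mul_def, comp_assoc, comp_assoc, comp_assoc, ← comp_assoc (adjoint (coreIncl k d)),
    adjoint_coreIncl_comp_coreIncl, one_def, id_comp]

theorem cornerIncl_star (hΘ : Θ.transpose = -Θ) (X : toeplitz (lowerRight Θ)) :
    cornerIncl hΘ (star X) = star (cornerIncl hΘ X) := by
  apply Subtype.ext
  rw [StarMemClass.coe_star, coe_cornerIncl, coe_cornerIncl, StarMemClass.coe_star, star_eq_adjoint,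
    star_eq_adjoint, adjoint_comp, adjoint_comp, adjoint_adjoint, comp_assoc]

theorem cornerIncl_one (hΘ : Θ.transpose = -Θ) : cornerIncl (k := k) (d := d) hΘ 1 = projQ Θ := by
  apply Subtype.ext
  rw [coe_cornerIncl, coe_projQ, OneMemClass.coe_one, one_def, id_comp]

theorem exists_mem_coreAlg_cornerIncl_eq (hΘ : Θ.transpose = -Θ) (X : toeplitz (lowerRight Θ)) :
    ∃ A ∈ coreAlg Θ, cornerIncl hΘ X = projQ Θ * A * projQ Θ :=
  ⟨_, (coreEquiv hΘ X).2, cornerIncl_eq hΘ X⟩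

theorem isEigen_projQ_mul_mul_projQ {A : toeplitz Θ} (hA : A ∈ coreAlg Θ) :
    IsEigen Θ (extendZero d r) 0 (projQ Θ * A * projQ Θ) := by
  have h := (isEigen_projQ.mul (isEigen_of_mem_coreAlg hA)).mul (isEigen_projQ (r := r))
  rwa [add_zero, add_zero] at h

theorem isEigen_cornerIncl (hΘ : Θ.transpose = -Θ) (X : toeplitz (lowerRight Θ)) :
    IsEigen Θ (extendZero d r) 0 (cornerIncl hΘ X) := by
  obtain ⟨A, hA, h⟩ := exists_mem_coreAlg_cornerIncl_eq hΘ X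
  rw [h]
  exact isEigen_projQ_mul_mul_projQ hA

/-- The functional `Y ↦ Z(β) φ(Q ι(Y) Q)` on `T_r(ℕᵈ, σ_{Θ_d})`. -/
def coreTrace (hΘ : Θ.transpose = -Θ) (r : Fin k → ℝ) (β : ℝ) (φ : WeakDual ℂ (toeplitz Θ)) :
    WeakDual ℂ (toeplitz (lowerRight Θ)) :=
  StrongDual.toWeakDual
    ((partitionFn r β : ℂ) • (WeakDual.toStrongDual φ).comp (cornerIncl hΘ))

theorem coreTrace_apply (hΘ : Θ.transpose = -Θ) (φ : WeakDual ℂ (toeplitz Θ))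
    (Y : toeplitz (lowerRight Θ)) :
    coreTrace hΘ r β φ Y = (partitionFn r β : ℂ) * φ (cornerIncl hΘ Y) :=
  rfl

theorem ofReal_partitionFn_ne_zero (hr : ∀ j, 0 < r j) (hβ : 0 < β) :
    (partitionFn r β : ℂ) ≠ 0 :=
  Complex.ofReal_ne_zero.2 (partitionFn_pos hr hβ).ne'

/-- Elements of the corner have frequency zero, where the KMS condition is the trace property. -/
theorem coreTrace_mem_tracialStates (hΘ : Θ.transpose = -Θ) (hr : ∀ j, 0 < r j) (hβ : 0 < β)
    {φ : WeakDual ℂ (toeplitz Θ)} (hφ : φ ∈ kmsStates (dynamics Θ (extendZero d r)) β) :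
    coreTrace hΘ r β φ ∈ tracialStates (toeplitz (lowerRight Θ)) := by
  refine ⟨⟨?_, fun a => ?_⟩, fun a b => ?_⟩
  · rw [coreTrace_apply, cornerIncl_one, kms_projQ hΘ hr hβ hφ,
      mul_inv_cancel₀ (ofReal_partitionFn_ne_zero hr hβ)]
  · rw [coreTrace_apply, cornerIncl_mul, cornerIncl_star]
    exact mul_nonneg (Complex.zero_le_real.2 (partitionFn_pos hr hβ).le) (hφ.1.2 _)
  · rw [coreTrace_apply, coreTrace_apply, cornerIncl_mul, cornerIncl_mul,
      kms_of_isEigen hφ (isEigen_cornerIncl hΘ a), mul_zero, Real.exp_zero, Complex.ofReal_one,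
      one_mul]

/-! ### Reconstruction of a KMS state -/

/-- The KMS condition moves `Q L_l^*`, of frequency `-⟨l, r⟩`, to the front: `φ(X L_l Q L_l^*) = exp
(-β ⟨l, r⟩) φ(Q L_l^* X L_l Q)`. -/
theorem kms_mul_stripProj (hΘ : Θ.transpose = -Θ) (hr : ∀ j, 0 < r j) (hβ : 0 < β)
    {φ : WeakDual ℂ (toeplitz Θ)} (hφ : φ ∈ kmsStates (dynamics Θ (extendZero d r)) β)
    (X : toeplitz Θ) (l : Fin k → ℕ) :
    φ (X * stripProj Θ l)
      = (gibbsWeight r β l : ℂ) * coreTrace hΘ r β φ (stripCompress hΘ l X) := by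
  have hs : IsEigen Θ (extendZero d r) (-pairing l r) (projQ Θ * star (gen Θ (inl d l))) := by
    have h := (isEigen_projQ (Θ := Θ) (r := r)).mul (isEigen_gen (inl d l)).star
    rwa [pairing_inl, zero_add] at h
  have h1 := kms_of_isEigen hφ hs (X * gen Θ (inl d l) * projQ Θ)
  have h2 : X * gen Θ (inl d l) * projQ Θ * (projQ Θ * star (gen Θ (inl d l)))
      = X * stripProj Θ l := by
    rw [stripProj]
    calc X * gen Θ (inl d l) * projQ Θ * (projQ Θ * star (gen Θ (inl d l)))
        = X * gen Θ (inl d l) * (projQ Θ * projQ Θ) * star (gen Θ (inl d l)) := by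
          simp only [mul_assoc]
      _ = _ := by rw [projQ_mul_projQ]; simp only [mul_assoc]
  have h3 : projQ Θ * star (gen Θ (inl d l)) * (X * gen Θ (inl d l) * projQ Θ)
      = cornerIncl hΘ (stripCompress hΘ l X) := by
    rw [← stripCompress_zero_conj, cornerIncl_stripCompress]
    simp only [mul_assoc]
  rw [h2, h3] at h1
  rw [coreTrace_apply, h1, gibbsWeight, Complex.ofReal_mul, Complex.ofReal_inv, ← mul_assoc,
    mul_right_comm ((partitionFn r β : ℂ)⁻¹), inv_mul_cancel₀ (ofReal_partitionFn_ne_zero hr hβ),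
    one_mul, ← mul_assoc, ← Complex.ofReal_mul, ← Real.exp_add]
  simp

theorem kms_stripProj (hΘ : Θ.transpose = -Θ) (hr : ∀ j, 0 < r j) (hβ : 0 < β)
    {φ : WeakDual ℂ (toeplitz Θ)} (hφ : φ ∈ kmsStates (dynamics Θ (extendZero d r)) β)
    (l : Fin k → ℕ) : φ (stripProj Θ l) = (gibbsWeight r β l : ℂ) := by
  have h := kms_mul_stripProj hΘ hr hβ hφ 1 l
  rwa [one_mul, stripCompress_one, (coreTrace_mem_tracialStates hΘ hr hβ hφ).1.1, mul_one] at h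

/-- The partial sums of the `P_l` need not converge in norm, but `φ` gives their complements mass `1
- ∑ w_l`, which tends to zero; Cauchy–Schwarz then makes the remainder `φ(X (1 - ∑ P_l))` vanish in
the limit. -/
theorem gibbs_coreTrace (hΘ : Θ.transpose = -Θ) (hr : ∀ j, 0 < r j) (hβ : 0 < β)
    {φ : WeakDual ℂ (toeplitz Θ)} (hφ : φ ∈ kmsStates (dynamics Θ (extendZero d r)) β) :
    gibbs hΘ r β (coreTrace hΘ r β φ) = φ := by
  refine DFunLike.ext _ _ fun X => (hasSum_gibbs hΘ hr hβ _ X).unique ?_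
  have hsum (F : Finset (Fin k → ℕ)) :
      ∑ l ∈ F, (gibbsWeight r β l : ℂ) * coreTrace hΘ r β φ (stripCompress hΘ l X)
        = φ X - φ (X * (1 - ∑ l ∈ F, stripProj Θ l)) := by
    rw [mul_sub, mul_one, map_sub, sub_sub_cancel, Finset.mul_sum, map_sum]
    exact Finset.sum_congr rfl fun l _ => (kms_mul_stripProj hΘ hr hβ hφ X l).symm
  have hbound (F : Finset (Fin k → ℕ)) : ‖φ (X * (1 - ∑ l ∈ F, stripProj Θ l))‖ ^ 2
      ≤ (φ (X * star X)).re * (1 - ∑ l ∈ F, gibbsWeight r β l) := by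
    have h := states_cauchy_schwarz hφ.1 (star X) (1 - ∑ l ∈ F, stripProj Θ l)
    rw [star_star, star_mul_self_one_sub_sum_stripProj] at h
    refine h.trans_eq ?_
    congr 1
    rw [map_sub, map_sum, hφ.1.1, Finset.sum_congr rfl fun l _ => kms_stripProj hΘ hr hβ hφ l,
      ← Complex.ofReal_sum, ← Complex.ofReal_one, ← Complex.ofReal_sub, Complex.ofReal_re]
  have hw : HasSum (gibbsWeight r β) 1 := by
    have h := (summable_gibbsWeight hr hβ).hasSum
    rwa [tsum_gibbsWeight hr hβ] at h
  have ht : Filter.Tendsto (fun F : Finset (Fin k → ℕ) =>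
      (φ (X * star X)).re * (1 - ∑ l ∈ F, gibbsWeight r β l)) Filter.atTop (nhds 0) := by
    have h : Filter.Tendsto (fun F : Finset (Fin k → ℕ) => ∑ l ∈ F, gibbsWeight r β l)
      Filter.atTop (nhds 1) := hw
    simpa using (h.const_sub 1).const_mul (φ (X * star X)).re
  have h2 : Filter.Tendsto (fun F : Finset (Fin k → ℕ) =>
      φ (X * (1 - ∑ l ∈ F, stripProj Θ l))) Filter.atTop (nhds 0) := by
    rw [tendsto_zero_iff_norm_tendsto_zero]
    have h3 := squeeze_zero (fun F => sq_nonneg _) hbound ht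
    have h4 := h3.sqrt
    simpa using h4
  have h5 : Filter.Tendsto (fun F : Finset (Fin k → ℕ) => ∑ l ∈ F, (gibbsWeight r β l : ℂ) *
      coreTrace hΘ r β φ (stripCompress hΘ l X)) Filter.atTop (nhds (φ X)) := by
    simp only [hsum]
    simpa using h2.const_sub (φ X)
  exact h5

/-- An element of the corner lives on strip `0`, so only the term `l = 0` of the series survives,
and its weight `Z(β)⁻¹` cancels the normalization. -/
theorem coreTrace_gibbs (hΘ : Θ.transpose = -Θ) (hr : ∀ j, 0 < r j) (hβ : 0 < β)
    (τ : WeakDual ℂ (toeplitz (lowerRight Θ))) : coreTrace hΘ r β (gibbs hΘ r β τ) = τ := by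
  refine DFunLike.ext _ _ fun Y => ?_
  have h0 : ∀ l : Fin k → ℕ, l ≠ 0 →
      (gibbsWeight r β l : ℂ) * τ (stripCompress hΘ l (cornerIncl hΘ Y)) = 0 := by
    intro l hl
    have h1 : adjoint (strip Θ l) ∘L coreIncl k d = 0 := by
      rw [← strip_zero (Θ := Θ), adjoint_strip_comp_strip, if_neg hl]
    have h2 : stripCompress hΘ l (cornerIncl hΘ Y) = 0 := by
      apply Subtype.ext
      rw [coe_stripCompress, coe_cornerIncl, comp_assoc,
        ← comp_assoc (adjoint (strip Θ l)), h1, zero_comp, ZeroMemClass.coe_zero]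
    rw [h2, map_zero, mul_zero]
  have h := (hasSum_gibbs hΘ hr hβ τ (cornerIncl hΘ Y)).unique (hasSum_single 0 h0)
  rw [coreTrace_apply, h, cornerIncl_eq, stripCompress_projQ_mul_mul_projQ,
    stripCompress_coreEquiv, gibbsWeight_zero, Complex.ofReal_inv, ← mul_assoc,
    mul_inv_cancel₀ (ofReal_partitionFn_ne_zero hr hβ), one_mul]

theorem gibbs_mem_kmsStates (hΘ : Θ.transpose = -Θ) (hr : ∀ j, 0 < r j) (hβ : 0 < β)
    {τ : WeakDual ℂ (toeplitz (lowerRight Θ))} (hτ : τ ∈ tracialStates (toeplitz (lowerRight Θ))) :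
    gibbs hΘ r β τ ∈ kmsStates (dynamics Θ (extendZero d r)) β :=
  mem_kmsStates_of_gen hΘ hβ.ne' (gibbs_mem_states hΘ hr hβ hτ.1) (gibbs_gen_mul hΘ hr hβ hτ)

/-! ### The homeomorphism -/

theorem continuous_gibbs (hΘ : Θ.transpose = -Θ) (hr : ∀ j, 0 < r j) (hβ : 0 < β) :
    Continuous fun τ : tracialStates (toeplitz (lowerRight Θ)) => gibbs hΘ r β τ.1 := by
  refine WeakDual.continuous_of_continuous_eval fun X => ?_
  have h1 : (fun τ : tracialStates (toeplitz (lowerRight Θ)) => gibbs hΘ r β τ.1 X)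
      = fun τ => ∑' l, (gibbsWeight r β l : ℂ) * τ.1 (stripCompress hΘ l X) :=
    funext fun τ => (hasSum_gibbs hΘ hr hβ τ.1 X).tsum_eq.symm
  rw [h1]
  -- The majorant is independent of `τ` because the domain consists of states, which are
  -- contractive.
  refine continuous_tsum (u := fun l => gibbsWeight r β l * ‖X‖) (fun l => ?_)
    ((summable_gibbsWeight hr hβ).mul_right _) fun l τ => ?_
  · exact continuous_const.mul ((WeakDual.eval_continuous _).comp continuous_subtype_val)
  · rw [norm_mul, Complex.norm_real, Real.norm_of_nonneg (gibbsWeight_nonneg hr hβ l)]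
    refine mul_le_mul_of_nonneg_left ?_ (gibbsWeight_nonneg hr hβ l)
    refine (states_norm_le τ.2.1 _).trans ((le_opNorm _ _).trans ?_)
    exact mul_le_of_le_one_left (norm_nonneg _) (norm_stripCompress_le hΘ l)

theorem continuous_coreTrace (hΘ : Θ.transpose = -Θ) :
    Continuous (coreTrace (k := k) (d := d) hΘ r β) := by
  refine WeakDual.continuous_of_continuous_eval fun Y => ?_
  simp only [coreTrace_apply]
  exact continuous_const.mul (WeakDual.eval_continuous _)

/-- The homeomorphism `τ ↦ T_β(τ ∘ ρ_Q⁻¹)` of the tracial states onto the KMS states. -/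
def traceKmsHomeomorph (hΘ : Θ.transpose = -Θ) (hr : ∀ j, 0 < r j) (hβ : 0 < β) :
    tracialStates (toeplitz (lowerRight Θ)) ≃ₜ kmsStates (dynamics Θ (extendZero d r)) β where
  toFun τ := ⟨gibbs hΘ r β τ.1, gibbs_mem_kmsStates hΘ hr hβ τ.2⟩
  invFun φ := ⟨coreTrace hΘ r β φ.1, coreTrace_mem_tracialStates hΘ hr hβ φ.2⟩
  left_inv τ := Subtype.ext (coreTrace_gibbs hΘ hr hβ τ.1)
  right_inv φ := Subtype.ext (gibbs_coreTrace hΘ hr hβ φ.2)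
  continuous_toFun := (continuous_gibbs hΘ hr hβ).subtype_mk _
  continuous_invFun := ((continuous_coreTrace hΘ).comp continuous_subtype_val).subtype_mk _

theorem traceKmsHomeomorph_apply (hΘ : Θ.transpose = -Θ) (hr : ∀ j, 0 < r j) (hβ : 0 < β)
    (τ : tracialStates (toeplitz (lowerRight Θ))) :
    (traceKmsHomeomorph hΘ hr hβ τ).1 = gibbs hΘ r β τ.1 :=
  rfl

theorem exists_gen_mul_star_gen_eq_smul (p q : Fin k → ℕ) (x y : Fin d → ℕ) :
    ∃ c : ℂ, gen Θ (inl d p + inr k x) * star (gen Θ (inl d q + inr k y))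
      = c • (gen Θ (inl d p) * gen Θ (inr k x) * star (gen Θ (inr k y)) *
        star (gen Θ (inl d q))) := by
  rw [gen_add, gen_add, star_smul, smul_mul_smul_comm, star_mul, ← mul_assoc]
  exact ⟨_, rfl⟩

end Converse

/-! ### Uniqueness, affinity and comparison with the series of the theorem -/

section Uniqueness

variable {k d : ℕ} {Θ : Matrix (Fin (k + d)) (Fin (k + d)) ℝ} {r : Fin k → ℝ} {β : ℝ}

theorem map_eq_of_eq_smul {E : Type*} [AddCommMonoid E] [Module ℂ E] [TopologicalSpace E]
    (f g : E →L[ℂ] ℂ) {a b : E} {c : ℂ} (hb : b = c • a) (h : f a = g a) : f b = g b := by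
  rw [hb, map_smul, map_smul, h]

theorem toeplitz_functional_ext (hΘ : Θ.transpose = -Θ) {f g : toeplitz Θ →L[ℂ] ℂ}
    (h : ∀ (p q : Fin k → ℕ) (x y : Fin d → ℕ),
      f (gen Θ (inl d p) * gen Θ (inr k x) * star (gen Θ (inr k y)) * star (gen Θ (inl d q))) =
      g (gen Θ (inl d p) * gen Θ (inr k x) * star (gen Θ (inr k y)) * star (gen Θ (inl d q)))) :
    f = g := by
  refine toeplitz_clm_ext hΘ fun p q => ?_
  obtain ⟨p, x, rfl⟩ := exists_eq_inl_add_inr p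
  obtain ⟨q, y, rfl⟩ := exists_eq_inl_add_inr q
  exact (exists_gen_mul_star_gen_eq_smul (Θ := Θ) p q x y).elim fun c hc =>
    map_eq_of_eq_smul f g hc (h p q x y)

theorem gibbs_unique (hΘ : Θ.transpose = -Θ) (hr : ∀ j, 0 < r j) (hβ : 0 < β)
    (τ : WeakDual ℂ (toeplitz (lowerRight Θ))) (ψ : WeakDual ℂ (toeplitz Θ))
    (h : ∀ (p q : Fin k → ℕ) (x y : Fin d → ℕ),
      ψ (gen Θ (inl d p) * gen Θ (inr k x) * star (gen Θ (inr k y)) * star (gen Θ (inl d q))) =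
        if p = q then
          τ (gen (lowerRight Θ) x * star (gen (lowerRight Θ) y)) * eulerProduct Θ r β p x y
        else 0) : ψ = gibbs hΘ r β τ :=
  WeakDual.toStrongDual.injective <| toeplitz_functional_ext hΘ fun p q x y =>
    (h p q x y).trans (gibbs_monomial hΘ hr hβ τ p q x y).symm

theorem WeakDual.eq_smul_add_smul_iff {E : Type*} [AddCommMonoid E] [Module ℂ E]
    [TopologicalSpace E] {f g h : WeakDual ℂ E} {s t : ℂ} :
    f = s • g + t • h ↔ ∀ a, f a = s * g a + t * h a :=
  ⟨fun e a => by rw [e]; rfl, fun e => DFunLike.ext _ _ e⟩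

theorem hasSum_smul_add_smul {ι : Type*} {w f g h : ι → ℂ} {F G H s t : ℂ}
    (hf : HasSum (fun i => w i * f i) F) (hg : HasSum (fun i => w i * g i) G)
    (hh : HasSum (fun i => w i * h i) H) (e : ∀ i, f i = s * g i + t * h i) :
    F = s * G + t * H := by
  refine hf.unique ?_
  have h1 := (hg.mul_left s).add (hh.mul_left t)
  have h2 : (fun i => w i * f i) = fun i => s * (w i * g i) + t * (w i * h i) := by
    funext i
    rw [e]
    ring
  rwa [h2]

theorem gibbs_affine (hΘ : Θ.transpose = -Θ) (hr : ∀ j, 0 < r j) (hβ : 0 < β)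
    {τ₁ τ₂ τ : WeakDual ℂ (toeplitz (lowerRight Θ))} {s t : ℂ} (h : τ = s • τ₁ + t • τ₂) :
    gibbs hΘ r β τ = s • gibbs hΘ r β τ₁ + t • gibbs hΘ r β τ₂ :=
  WeakDual.eq_smul_add_smul_iff.2 fun X =>
    hasSum_smul_add_smul (hasSum_gibbs hΘ hr hβ τ X) (hasSum_gibbs hΘ hr hβ τ₁ X)
      (hasSum_gibbs hΘ hr hβ τ₂ X) fun l =>
      WeakDual.eq_smul_add_smul_iff.1 h (stripCompress hΘ l X)

/-- Undoing `ρ_Q` and the identification of the core turns compression by `Q` into `S_0`, and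
`S_0(L_l^* X L_l) = S_l(X)`. -/
theorem seriesTerm_eq (hΘ : Θ.transpose = -Θ) (τ : WeakDual ℂ (toeplitz (lowerRight Θ)))
    (X : toeplitz Θ) (l : Fin k → ℕ) :
    seriesTerm Θ r β (fun Y => τ ((coreEquiv hΘ).symm ((cornerEquiv hΘ).symm Y))) X l
      = (gibbsWeight r β l : ℂ) * τ (stripCompress hΘ l X) := by
  rw [seriesTerm, coreEquiv_symm_cornerEquiv_symm, stripCompress_zero_conj, gibbsWeight]

end Uniqueness

end ToeplitzTorus

end

/-! ### The main theorem -/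

set_option maxHeartbeats 2000000 in
theorem mainTheorem2 (k d : ℕ) (Θ : Matrix (Fin (k + d)) (Fin (k + d)) ℝ)
    (hΘ : Θ.transpose = -Θ) (r : Fin k → ℝ) (hr : ∀ j, 0 < r j) (β : ℝ) (hβ : 0 < β) :
    -- the canonical identification of `T_r(ℕᵈ, σ_{Θ_d})` with `C*(L_x : x ∈ 0_k × ℕᵈ)`,
    -- and the compression isomorphism `ρ_Q` onto the corner
    ∃ (ι : toeplitz (lowerRight Θ) ≃⋆ₐ[ℂ] coreAlg Θ) (ρ : coreAlg Θ ≃⋆ₐ[ℂ] cornerQ Θ),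
      (∀ x : Fin d → ℕ, (ι (gen (lowerRight Θ) x) : toeplitz Θ) = gen Θ (inr k x)) ∧
      (∀ X : coreAlg Θ, ρ X = compressQ Θ (X : toeplitz Θ)) ∧
      ∃ Φ : tracialStates (toeplitz (lowerRight Θ)) ≃ₜ
          kmsStates (dynamics Θ (extendZero d r)) β,
        -- `Φ τ = T_β(τ ∘ ρ_Q⁻¹)`
        (∀ (τ : tracialStates (toeplitz (lowerRight Θ))) (X : toeplitz Θ),
          HasSum (seriesTerm Θ r β (fun Y => τ.1 (ι.symm (ρ.symm Y))) X) ((Φ τ).1 X)) ∧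
        -- the formula on the spanning elements
        (∀ (τ : tracialStates (toeplitz (lowerRight Θ))) (p q : Fin k → ℕ) (x y : Fin d → ℕ),
          (Φ τ).1 (gen Θ (inl d p) * gen Θ (inr k x) * star (gen Θ (inr k y)) *
              star (gen Θ (inl d q))) =
            if p = q then
              τ.1 (gen (lowerRight Θ) x * star (gen (lowerRight Θ) y)) *
                eulerProduct Θ r β p x y
            else 0) ∧
        -- the formula determines the state
        (∀ (τ : tracialStates (toeplitz (lowerRight Θ))) (ψ : WeakDual ℂ (toeplitz Θ)),
          (∀ (p q : Fin k → ℕ) (x y : Fin d → ℕ),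
            ψ (gen Θ (inl d p) * gen Θ (inr k x) * star (gen Θ (inr k y)) *
                star (gen Θ (inl d q))) =
              if p = q then
                τ.1 (gen (lowerRight Θ) x * star (gen (lowerRight Θ) y)) *
                  eulerProduct Θ r β p x y
              else 0) →
          ψ = (Φ τ).1) ∧
        -- `Φ` is affine
        (∀ (τ₁ τ₂ τ : tracialStates (toeplitz (lowerRight Θ))) (s t : ℝ), 0 ≤ s → 0 ≤ t →
          s + t = 1 → τ.1 = (s : ℂ) • τ₁.1 + (t : ℂ) • τ₂.1 →
          (Φ τ).1 = (s : ℂ) • (Φ τ₁).1 + (t : ℂ) • (Φ τ₂).1) := by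
  refine ⟨coreEquiv hΘ, cornerEquiv hΘ, coreEquiv_gen hΘ, cornerEquiv_apply hΘ,
    traceKmsHomeomorph hΘ hr hβ, fun τ X => ?_, fun τ p q x y => ?_, fun τ ψ h => ?_,
    fun τ₁ τ₂ τ s t _ _ _ h => ?_⟩
  · rw [traceKmsHomeomorph_apply, funext (seriesTerm_eq hΘ τ.1 X)]
    exact hasSum_gibbs hΘ hr hβ τ.1 X
  · exact gibbs_monomial hΘ hr hβ τ.1 p q x y
  · exact gibbs_unique hΘ hr hβ τ.1 ψ h
  · exact gibbs_affine hΘ hr hβ h
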